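/- **Definitions.** For a monoid $R$ let $E(R)$ be its set of idempotents and $G(R)$ its unit group; $G(R)$ acts on $E(R)$ by conjugation. $R$ is *factorisable* if $R=E(R)G(R)=G(R)E(R)$ and the idempotents of $R$ commute; then $E(R)$ is a semi-lattice, ordered by $e\le f\iff ef=fe=e$. For $e\in E(R)$ put $$W(e)=\{w\in G(R)\mid we=ew\},\qquad W_\star(e)=\{w\in G(R)\mid we=ew=e\}.$$ A *generalised Renner–Coxeter system* is a triple $(R,\Lambda,S)$, where $R$ is a monoid, $\Lambda\subseteq E(R)$ and $S\subseteq G(R)$, such that 1. $R$ is factorisable; 2. $\Lambda$ contains exactly one element of each $G(R)$-orbit in $E(R)$, and is closed under multiplication; 3. $(G(R),S)$ is a Coxeter system; 4. for all $e_1\le e_2$ in $E(R)$ there are $w\in G(R)$ and $f_1\le f_2$ in $\Lambda$ with $wf_iw^{-1}=e_i$ for $i=1,2$; 5. for every $e\in\Lambda$ the subgroups $W(e)$ and $W_\star(e)$ are generated by subsets of $S$; 6. if $e\le f$ in $\Lambda$, then $\lambda^\star(e)\subseteq\lambda^\star(f)$, where $\lambda^\star(e)=\{s\in S\mid se=es\ne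 e\}$. Put $\Lambda_\circ=\Lambda\setminus\{1\}$. For $r\in R$ the *length* $\ell(r)$ is the minimum, over all words on $S\cup\Lambda_\circ$ that represent $r$, of the number of letters of the word that lie in $S$. One has $\ell(er)\le\ell(r)$ for $e\in\Lambda_\circ$. **Theorem.** Let $(R,\Lambda,S)$ be a generalised Renner–Coxeter system, let $A$ be a unital associative ring and let $q$ be a central element of $A$ (any element, if $A$ is commutative). Let $V$ be the free $A$-module with basis $(T_r)_{r\in R}$. There is a unique structure of unital associative $A$-algebra on $V$ such that $T_1$ is the unit and, for all $r\in R$, $s\in S$ and $e\in\Lambda_\circ$, $$T_sT_r=\begin{cases}T_{sr}&\text{if }\ell(sr)=\ell(r)+1,\\ qT_r&\text{if }\ell(sr)=\ell(r),\\ (q-1)T_r+qT_{sr}&\text{if }\ell(sr)=\ell(r)-1,\end{cases}\qquad T_eT_r=q^{\ell(r)-\ell(er)}T_{er}.$$ Here, if $A$ is not commutative, $V$ is regarded as an $A$-bimodule through $(bT_r)a=(ba)T_r$, and an $A$-algebra structure on $V$ means a biadditive associative unital product with $(ax)y=a(xy)$, $(xa)y=x(ay)$ and $(xy)a=x(ya)$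 for all $a\in A$ and $x,y\in V$; if $A$ is commutative, this is an $A$-algebra structure in the usual sense. In particular, for $A=\mathbb Z[q]$ with $q$ an indeterminate, there is a unique such structure; the resulting $\mathbb Z[q]$-algebra is the *generic Hecke algebra* $\mathcal H(R)$. -/

import Mathlib

namespace RennerCoxeter

section System

variable {R : Type*} [Monoid R]

/-- A monoid `R` is factorisable if `R = E(R) G(R) = G(R) E(R)`, where `E(R)` is the set of
idempotents and `G(R) = Rˣ` the unit group, and if idempotents commute
(so that `E(R)` is a semi-lattice). -/
structure IsFactorisable (R : Type*) [Monoid R] : Prop where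
  eq_idem_mul_unit : ∀ r : R, ∃ (e : R) (u : Rˣ), IsIdempotentElem e ∧ r = e * u
  eq_unit_mul_idem : ∀ r : R, ∃ (u : Rˣ) (e : R), IsIdempotentElem e ∧ r = u * e
  idem_comm : ∀ e f : R, IsIdempotentElem e → IsIdempotentElem f → e * f = f * e

/-- The order of the semi-lattice of idempotents: `e ≤ f` if and only if `ef = fe = e`. -/
def IdemLE (e f : R) : Prop := e * f = e ∧ f * e = e

/-- The action of the unit group by conjugation: `w e w⁻¹`. -/
def conj (w : Rˣ) (e : R) : R := (w : R) * e * ((w⁻¹ : Rˣ) : R)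

/-- `W(e) = {w ∈ G(R) ∣ we = ew}`. -/
def centralizer (e : R) : Subgroup Rˣ where
  carrier := {w | (w : R) * e = e * w}
  one_mem' := by simp
  mul_mem' := by
    intro a b ha hb
    simp only [Set.mem_ofPred_eq, Units.val_mul] at *
    rw [mul_assoc, hb, ← mul_assoc, ha, mul_assoc]
  inv_mem' := by
    intro a ha
    simp only [Set.mem_ofPred_eq] at *
    rw [Units.inv_mul_eq_iff_eq_mul, ← mul_assoc, Units.eq_mul_inv_iff_mul_eq, ha]

/-- `W_⋆(e) = {w ∈ G(R) ∣ we = ew = e}`. -/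
def fixer (e : R) : Subgroup Rˣ where
  carrier := {w | (w : R) * e = e ∧ e * w = e}
  one_mem' := by simp
  mul_mem' := by
    rintro a b ⟨ha, ha'⟩ ⟨hb, hb'⟩
    refine ⟨?_, ?_⟩
    · rw [Units.val_mul, mul_assoc, hb, ha]
    · rw [Units.val_mul, ← mul_assoc, ha', hb']
  inv_mem' := by
    rintro a ⟨ha, ha'⟩
    exact ⟨by rw [Units.inv_mul_eq_iff_eq_mul, ha], by rw [Units.mul_inv_eq_iff_eq_mul, ha']⟩

/-- `λ^⋆(e) = {s ∈ S ∣ se = es ≠ e}`. -/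
def upperType (S : Set Rˣ) (e : R) : Set Rˣ :=
  {s | s ∈ S ∧ (s : R) * e = e * s ∧ e * s ≠ e}

/-- `(W, S)` is a Coxeter system, for a subset `S` of the group `W`. -/
def IsCoxeterPair {W : Type*} [Group W] (S : Set W) : Prop :=
  ∃ (M : CoxeterMatrix S) (cs : CoxeterSystem M W), ∀ s : S, cs.simple s = s

/-- The subgroup `H` is a standard parabolic subgroup `W_I`, `I ⊆ S`, of `W`. -/
def IsStandardParabolic {W : Type*} [Group W] (S : Set W) (H : Subgroup W) : Prop :=
  ∃ I : Set W, I ⊆ S ∧ H = Subgroup.closure I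

/-- Generalised Renner--Coxeter systems `(R, Λ, S)`. -/
structure IsSystem (Λ : Set R) (S : Set Rˣ) : Prop where
  factorisable : IsFactorisable R
  idem_of_mem : ∀ e ∈ Λ, IsIdempotentElem e
  transversal : ∀ e : R, IsIdempotentElem e → ∃! f : R, f ∈ Λ ∧ ∃ w : Rˣ, conj w e = f
  mul_mem : ∀ e ∈ Λ, ∀ f ∈ Λ, e * f ∈ Λ
  coxeter : IsCoxeterPair S
  conj_pair : ∀ e₁ e₂ : R, IsIdempotentElem e₁ → IsIdempotentElem e₂ → IdemLE e₁ e₂ →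
    ∃ (w : Rˣ) (f₁ f₂ : R), f₁ ∈ Λ ∧ f₂ ∈ Λ ∧ IdemLE f₁ f₂ ∧ conj w f₁ = e₁ ∧ conj w f₂ = e₂
  parabolic_centralizer : ∀ e ∈ Λ, IsStandardParabolic S (centralizer e)
  parabolic_fixer : ∀ e ∈ Λ, IsStandardParabolic S (fixer e)
  upperType_mono : ∀ e ∈ Λ, ∀ f ∈ Λ, IdemLE e f → upperType S e ⊆ upperType S f

/-- The alphabet `S ∪ Λ∘` with `Λ∘ = Λ \ {1}`. -/
abbrev Letter (Λ : Set R) (S : Set Rˣ) : Type _ := S ⊕ (Λ \ {1} : Set R)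

/-- The element of `R` given by a letter. -/
def Letter.val {Λ : Set R} {S : Set Rˣ} : Letter Λ S → R
  | Sum.inl s => ((s : Rˣ) : R)
  | Sum.inr e => (e : R)

/-- Letters in `S` have length `1`, letters in `Λ∘` have length `0`. -/
def Letter.len {Λ : Set R} {S : Set Rˣ} : Letter Λ S → ℕ
  | Sum.inl _ => 1
  | Sum.inr _ => 0

/-- The element of `R` represented by a word. -/
def wordVal {Λ : Set R} {S : Set Rˣ} (ω : List (Letter Λ S)) : R := (ω.map Letter.val).prod

/-- The length of a word. -/
def wordLen {Λ : Set R} {S : Set Rˣ} (ω : List (Letter Λ S)) : ℕ := (ω.map Letter.len).sum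

/-- The length `ℓ(r)`: the minimal length of a word over `S ∪ Λ∘` representing `r`. -/
noncomputable def length (Λ : Set R) (S : Set Rˣ) (r : R) : ℕ :=
  sInf {n | ∃ ω : List (Letter Λ S), wordVal ω = r ∧ wordLen ω = n}

/-- In a generalised Renner--Coxeter system every element is represented by a word, so the
minimum defining the length is taken over a nonempty set. -/
theorem IsSystem.exists_word {Λ : Set R} {S : Set Rˣ} (h : IsSystem Λ S) (r : R) :
    ∃ ω : List (Letter Λ S), wordVal ω = r := by
  have happ : ∀ a b : List (Letter Λ S), wordVal (a ++ b) = wordVal a * wordVal b := by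
    intro a b; simp [wordVal]
  have hu : ∀ u : Rˣ, ∃ ω : List (Letter Λ S), wordVal ω = (u : R) := by
    obtain ⟨M, cs, hcs⟩ := h.coxeter
    intro u
    obtain ⟨l, rfl⟩ := cs.wordProd_surjective u
    induction l with
    | nil => exact ⟨[], by simp [wordVal]⟩
    | cons s l ih =>
      obtain ⟨ω, hω⟩ := ih
      refine ⟨[Sum.inl s] ++ ω, ?_⟩
      rw [happ, hω, cs.wordProd_cons, hcs]
      simp [wordVal, Letter.val]
  have hΛ : ∀ e ∈ Λ, ∃ ω : List (Letter Λ S), wordVal ω = e := by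
    intro e he
    by_cases h1 : e = 1
    · exact ⟨[], by simp [wordVal, h1]⟩
    · exact ⟨[Sum.inr ⟨e, he, h1⟩], by simp [wordVal, Letter.val]⟩
  obtain ⟨e, u, he, rfl⟩ := h.factorisable.eq_idem_mul_unit r
  obtain ⟨f, ⟨hf, w, hw⟩, -⟩ := h.transversal e he
  obtain ⟨a, ha⟩ := hu w⁻¹
  obtain ⟨b, hb⟩ := hΛ f hf
  obtain ⟨c, hc⟩ := hu (w * u)
  refine ⟨a ++ b ++ c, ?_⟩
  rw [happ, happ, ha, hb, hc, ← hw, conj]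
  simp [mul_assoc]

/-- Left multiplication by an element of `Λ∘` does not increase the length. -/
theorem IsSystem.length_mul_le {Λ : Set R} {S : Set Rˣ} (h : IsSystem Λ S) {e : R}
    (he : e ∈ Λ \ {1}) (r : R) : length Λ S (e * r) ≤ length Λ S r := by
  obtain ⟨ω₀, h₀⟩ := h.exists_word r
  have hne : {n | ∃ ω : List (Letter Λ S), wordVal ω = r ∧ wordLen ω = n}.Nonempty :=
    ⟨_, ω₀, h₀, rfl⟩
  obtain ⟨ω, hω, hl⟩ := Nat.sInf_mem hne
  refine Nat.sInf_le ⟨Sum.inr ⟨e, he⟩ :: ω, ?_, ?_⟩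
  · rw [← hω]; simp [wordVal, Letter.val]
  · rw [length, ← hl]; simp [wordLen, Letter.len]

end System

section Hecke

variable {R : Type*} {A : Type*} [Ring A]

/-- The basis element `T_r` of the free `A`-module on `R`. -/
noncomputable def T (A : Type*) [Ring A] {R : Type*} (r : R) : R →₀ A := Finsupp.single r 1

/-- A biadditive product on the free `A`-module `V` on `R` makes `V` a unital associative
`A`-algebra with unit `one`. Here `V` carries its natural bimodule structure, in which
`(b T_r) a = (b a) T_r`; the right action of `a` on `x` is written `MulOpposite.op a • x`.
If `A` is commutative, then `x a = a x`, and one gets precisely the unital associative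
`A`-algebra structures in the usual sense, see `isAlgebraMul_iff`. -/
structure IsAlgebraMul (one : R →₀ A) (mul : (R →₀ A) →+ (R →₀ A) →+ (R →₀ A)) : Prop where
  one_mul : ∀ x, mul one x = x
  mul_one : ∀ x, mul x one = x
  mul_assoc : ∀ x y z, mul (mul x y) z = mul x (mul y z)
  smul_mul : ∀ (a : A) (x y), mul (a • x) y = a • mul x y
  smul_middle : ∀ (a : A) (x y), mul (MulOpposite.op a • x) y = mul x (a • y)
  mul_smul : ∀ (a : A) (x y), mul x (MulOpposite.op a • y) = MulOpposite.op a • mul x y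

/-- Over a commutative ring: a bilinear associative product with unit `one`. -/
theorem isAlgebraMul_iff {A : Type*} [CommRing A] (one : R →₀ A)
    (mul : (R →₀ A) →+ (R →₀ A) →+ (R →₀ A)) :
    IsAlgebraMul one mul ↔
      (∀ x, mul one x = x) ∧ (∀ x, mul x one = x) ∧
      (∀ x y z, mul (mul x y) z = mul x (mul y z)) ∧
      (∀ (a : A) (x y), mul (a • x) y = a • mul x y) ∧
      (∀ (a : A) (x y), mul x (a • y) = a • mul x y) := by
  constructor
  · intro h
    refine ⟨h.one_mul, h.mul_one, h.mul_assoc, h.smul_mul, fun a x y => ?_⟩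
    simpa only [op_smul_eq_smul] using h.mul_smul a x y
  · rintro ⟨h1, h2, h3, h4, h5⟩
    exact ⟨h1, h2, h3, h4, fun a x y => by rw [op_smul_eq_smul, h4, h5],
      fun a x y => by rw [op_smul_eq_smul, op_smul_eq_smul, h5]⟩

/-- The product `mul` is a unital associative `A`-algebra structure on the free `A`-module with
basis `(T_r)`, with unit `T_1`, in which left multiplication by the `T_x`, `x ∈ S ∪ Λ∘`, is given
by the Hecke rules with parameter `q`. In a generalised Renner--Coxeter system the exponent in
the last rule is not truncated, see `IsSystem.length_mul_le`. -/
structure IsHeckeMul [Monoid R] (Λ : Set R) (S : Set Rˣ) (q : A)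
    (mul : (R →₀ A) →+ (R →₀ A) →+ (R →₀ A)) : Prop where
  isAlgebraMul : IsAlgebraMul (T A (1 : R)) mul
  simple_of_gt : ∀ s ∈ S, ∀ r : R, length Λ S (s * r) = length Λ S r + 1 →
    mul (T A (s : R)) (T A r) = T A ((s : R) * r)
  simple_of_eq : ∀ s ∈ S, ∀ r : R, length Λ S (s * r) = length Λ S r →
    mul (T A (s : R)) (T A r) = q • T A r
  simple_of_lt : ∀ s ∈ S, ∀ r : R, length Λ S (s * r) + 1 = length Λ S r →
    mul (T A (s : R)) (T A r) = (q - 1) • T A r + q • T A ((s : R) * r)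
  idem : ∀ e ∈ Λ \ {1}, ∀ r : R,
    mul (T A e) (T A r) = q ^ (length Λ S r - length Λ S (e * r)) • T A (e * r)

end Hecke

end RennerCoxeter

/-! ### The exchange property for Coxeter systems. -/

namespace CoxeterSystem

variable {B W : Type*} [Group W] {M : CoxeterMatrix B} (cs : CoxeterSystem M W)

/-! For each letter `x` let `L_x` be the operator on `V` prescribed for left multiplication, and
`R_x` its mirror image. The heart of the proof is that every `L_x` commutes with every `R_y`
(`commute_leftOp_rightOp`). Along a word of minimal length for `r` no coefficients arise, so both
the `L`'s and the `R`'s carry `T_1` to `T_r`. Define `T_r y` by applying the `L`'s of such a word to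
`y`; since the `R`'s commute with this, right multiplication by `T_r` is the composite of the `R`'s,
and associativity is the commutation again. Uniqueness holds because associativity forces this
formula for `T_r y`.

Commutation is a question about lengths. A simple reflection changes the length by one or fixes the
element. Two simple reflections on opposite sides need the folding property `mul_left_eq_mul_right`;
a simple reflection and an idempotent need the fact that multiplying by an idempotent cannot turn an
ascent into a descent (`length_mul_idem_le`, `length_idem_mul_le`).

These facts are read off from normal forms `r = w₁ e w₂` with `e ∈ Λ`, `w₁` minimal modulo `W_⋆(e)`
and `w₂` minimal modulo `W(e)`, for which `ℓ(r) = ℓ(w₁) + ℓ(w₂)` (`length_of_leftNormal`). Normal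
forms multiply thanks to `mul_mul_eq_of_reduced`: if `x` is doubly reduced for `W(f)` and `W(e)`,
then `f x e` is an element of `Λ` fixed by `x`. Below, `W^⋆(e)` is the subgroup generated by the
simple reflections in `W(e)` outside `W_⋆(e)`. -/

theorem alternatingWord_two_mul_succ (i j : B) (m : ℕ) :
    alternatingWord i j (2 * (m + 1)) = i :: j :: alternatingWord i j (2 * m) := by
  rw [Nat.mul_succ, alternatingWord_succ', alternatingWord_succ']
  simp

theorem reverse_alternatingWord_two_mul (i j : B) (m : ℕ) :
    (alternatingWord i j (2 * m)).reverse = alternatingWord j i (2 * m) := by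
  induction m with
  | zero => simp [alternatingWord]
  | succ m ih =>
    rw [alternatingWord_two_mul_succ j i, ← ih, Nat.mul_succ, alternatingWord_succ,
      alternatingWord_succ]
    simp

open Classical in
/-- The action of a simple reflection on `W × ℤ/2` by which the parity of the number of
occurrences of an element in an inversion sequence is recorded. -/
noncomputable def inversionAct (i : B) : Function.End (W × ZMod 2) :=
  fun p => (cs.simple i * p.1 * cs.simple i, p.2 + if p.1 = cs.simple i then 1 else 0)

open Classical in
-- A letter adds to the counter exactly when the current conjugate of `p.1` equals that reflection,
-- that is, when `p.1` is the corresponding entry of the inversion sequence.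
theorem prod_map_inversionAct (ω : List B) (p : W × ZMod 2) :
    (ω.map cs.inversionAct).prod p =
      (cs.wordProd ω * p.1 * (cs.wordProd ω)⁻¹, p.2 + ((cs.rightInvSeq ω).count p.1 : ℕ)) := by
  induction ω with
  | nil => simp; rfl
  | cons i ω ih =>
    rw [List.map_cons, List.prod_cons]
    change cs.inversionAct i ((ω.map cs.inversionAct).prod p) = _
    have hiff : cs.wordProd ω * p.1 * (cs.wordProd ω)⁻¹ = cs.simple i ↔
        (cs.wordProd ω)⁻¹ * cs.simple i * cs.wordProd ω = p.1 := by
      constructor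
      · intro h; rw [← h]; group
      · intro h; rw [← h]; group
    simp only [mul_assoc] at hiff
    rw [ih, inversionAct, rightInvSeq, List.count_cons, wordProd_cons]
    simp only [hiff, beq_iff_eq, mul_inv_rev, inv_simple, mul_assoc, Nat.cast_add, add_assoc,
      Nat.cast_ite, Nat.cast_one, Nat.cast_zero]

theorem prod_map_alternatingWord {G : Type*} [Monoid G] (f : B → G) (i j : B) (m : ℕ) :
    ((alternatingWord i j (2 * m)).map f).prod = (f i * f j) ^ m := by
  induction m with
  | zero => simp [alternatingWord]
  | succ m ih => rw [alternatingWord_two_mul_succ]; simp [ih, pow_succ', mul_assoc]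

/-- Entries at distance `M i j` coincide because `(s_i s_j) ^ M i j = 1`. Hence every reflection
occurs an even number of times, and the braid relations act trivially on the parity. -/
theorem rightInvSeq_alternatingWord_eq_append (i j : B) :
    ∃ l : List W, cs.rightInvSeq (alternatingWord i j (2 * M i j)) = l ++ l := by
  have h : ∃ l : List W, cs.leftInvSeq (alternatingWord j i (2 * M i j)) = l ++ l := by
    set L := cs.leftInvSeq (alternatingWord j i (2 * M i j)) with hL
    have hlen : L.length = 2 * M i j := by simp [hL]
    refine ⟨L.take (M i j), ?_⟩
    have hdrop : L.drop (M i j) = L.take (M i j) := by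
      apply List.ext_getElem
      · simp [hlen]; omega
      · intro k h1 h2
        simp only [List.length_drop, hlen, List.length_take] at h1 h2
        rw [List.getElem_drop, List.getElem_take]
        simp only [hL]
        rw [getElem_leftInvSeq_alternatingWord _ _ _ _ _ (by omega),
          getElem_leftInvSeq_alternatingWord _ _ _ _ _ (by omega),
          prod_alternatingWord_eq_mul_pow, prod_alternatingWord_eq_mul_pow]
        rw [show (2 * (M i j + k) + 1) / 2 = M i j + k by omega,
          show (2 * k + 1) / 2 = k by omega, pow_add, simple_mul_simple_pow]
        simp
    conv_lhs => rw [← List.take_append_drop (M i j) L, hdrop]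
  obtain ⟨l, hl⟩ := h
  refine ⟨l.reverse, ?_⟩
  rw [← reverse_alternatingWord_two_mul, rightInvSeq_reverse, hl, List.reverse_append]

theorem isLiftable_inversionAct : M.IsLiftable cs.inversionAct := by
  classical
  intro i j
  funext p
  obtain ⟨l, hl⟩ := cs.rightInvSeq_alternatingWord_eq_append i j
  rw [← prod_map_alternatingWord, prod_map_inversionAct, hl, wordProd, prod_map_alternatingWord,
    simple_mul_simple_pow, List.count_append, Nat.cast_add, CharTwo.add_self_eq_zero]
  simp; rfl

open Classical in
-- The letterwise action descends to `W`, so the parity it records depends only on the group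
-- element.
theorem count_rightInvSeq_congr {ω ω' : List B} (h : cs.wordProd ω = cs.wordProd ω') (t : W) :
    (((cs.rightInvSeq ω).count t : ℕ) : ZMod 2) = ((cs.rightInvSeq ω').count t : ℕ) := by
  have key : ∀ ω : List B, cs.lift ⟨_, cs.isLiftable_inversionAct⟩ (cs.wordProd ω) =
      (ω.map cs.inversionAct).prod := by
    intro ω
    rw [wordProd, map_list_prod, List.map_map]
    congr 1
    apply List.map_congr_left
    intro i _
    exact cs.lift_apply_simple cs.isLiftable_inversionAct i
  have h2 := congrFun ((key ω).symm.trans ((congrArg _ h).trans (key ω'))) (t, 0)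
  rw [prod_map_inversionAct, prod_map_inversionAct] at h2
  simpa using congrArg Prod.snd h2

/-- The exchange property. -/
theorem exists_eraseIdx_of_isRightDescent {ω : List B} {i : B}
    (h : cs.IsRightDescent (cs.wordProd ω) i) :
    ∃ j < ω.length, cs.wordProd ω * cs.simple i = cs.wordProd (ω.eraseIdx j) := by
  classical
  -- For a reduced word `μ` of `w s_i`, the reflection `s_i` occurs exactly once in the inversion
  -- sequence of `μ i`. By parity it occurs in that of `ω`, and its position gives the letter to
  -- delete.
  obtain ⟨μ, hμ, hμ'⟩ := cs.exists_isReduced (cs.wordProd ω * cs.simple i)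
  have hnot : cs.simple i ∉ cs.rightInvSeq μ := by
    intro hmem
    have := (cs.isRightInversion_of_mem_rightInvSeq hμ hmem).2
    rw [← hμ', simple_mul_simple_cancel_right] at this
    exact absurd h (by rw [IsRightDescent]; omega)
  have hcount : ((cs.rightInvSeq (μ.concat i)).count (cs.simple i)) = 1 := by
    rw [rightInvSeq_concat, List.concat_eq_append, List.count_append,
      List.count_eq_zero_of_not_mem]
    · simp
    · intro hmem
      obtain ⟨t, ht, hte⟩ := List.mem_map.1 hmem
      apply hnot
      rw [MulAut.conj_apply, inv_simple] at hte
      have : t = cs.simple i := by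
        have h2 := congrArg (fun x => cs.simple i * x * cs.simple i) hte
        simpa [mul_assoc] using h2
      rwa [← this]
  have hc := cs.count_rightInvSeq_congr (ω := ω) (ω' := μ.concat i)
    (by rw [wordProd_concat, ← hμ', simple_mul_simple_cancel_right]) (cs.simple i)
  rw [hcount] at hc
  have hmem : cs.simple i ∈ cs.rightInvSeq ω := by
    by_contra hn
    rw [List.count_eq_zero_of_not_mem hn] at hc
    exact absurd hc (by decide)
  obtain ⟨j, hj, hje⟩ := List.mem_iff_getElem.mp hmem
  refine ⟨j, by simpa using hj, ?_⟩
  rw [← wordProd_mul_getD_rightInvSeq, List.getD_eq_getElem _ 1 hj, hje]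

/-- Letters are appended one at a time; a letter that is a descent cancels against an earlier one by
the exchange property, so only deletions occur. -/
theorem exists_isReduced_sublist (ω : List B) :
    ∃ ω' : List B, ω'.Sublist ω ∧ cs.IsReduced ω' ∧ cs.wordProd ω' = cs.wordProd ω := by
  induction ω using List.reverseRecOn with
  | nil => exact ⟨[], List.Sublist.refl _, by simp [IsReduced], rfl⟩
  | append_singleton ω i ih =>
    obtain ⟨μ, hsub, hred, hprod⟩ := ih
    by_cases hd : cs.IsRightDescent (cs.wordProd μ) i
    · obtain ⟨j, hj, he⟩ := cs.exists_eraseIdx_of_isRightDescent hd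
      refine ⟨μ.eraseIdx j, ((List.eraseIdx_sublist _ _).trans hsub).trans
        (List.sublist_append_left _ _), ?_, ?_⟩
      · have h1 := cs.isRightDescent_iff.1 hd
        rw [IsReduced, ← he, List.length_eraseIdx_of_lt hj]
        rw [hred.eq] at h1
        omega
      · rw [← he, hprod, wordProd_append, wordProd_singleton]
    · refine ⟨μ ++ [i], hsub.append (List.Sublist.refl _), ?_, ?_⟩
      · rw [IsReduced, wordProd_append, wordProd_singleton, cs.not_isRightDescent_iff.1 hd,
          hred.eq]
        simp
      · rw [wordProd_append, wordProd_append, hprod]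

end CoxeterSystem

/-! ### Minimal coset representatives of standard parabolic subgroups. -/

namespace CoxeterSystem

variable {B W : Type*} [Group W] {M : CoxeterMatrix B} (cs : CoxeterSystem M W)

/-- The standard parabolic subgroup `W_I`. -/
def parabolic (I : Set B) : Subgroup W := Subgroup.closure (cs.simple '' I)

/-- `x` has no right descent in `I`. -/
def IsRightReduced (I : Set B) (x : W) : Prop := ∀ i ∈ I, ¬ cs.IsRightDescent x i

/-- `x` has no left descent in `I`. -/
def IsLeftReduced (I : Set B) (x : W) : Prop := ∀ i ∈ I, ¬ cs.IsLeftDescent x i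

variable {cs} {I J K : Set B} {x y a b w : W} {i j : B}

theorem isRightReduced_inv_iff : cs.IsRightReduced I x⁻¹ ↔ cs.IsLeftReduced I x := by
  simp [IsRightReduced, IsLeftReduced, cs.isRightDescent_inv_iff]

theorem isLeftReduced_inv_iff : cs.IsLeftReduced I x⁻¹ ↔ cs.IsRightReduced I x := by
  simp [IsRightReduced, IsLeftReduced, cs.isLeftDescent_inv_iff]

theorem IsRightReduced.mono (h : cs.IsRightReduced I x) (hJ : J ⊆ I) : cs.IsRightReduced J x :=
  fun i hi => h i (hJ hi)

theorem IsLeftReduced.mono (h : cs.IsLeftReduced I x) (hJ : J ⊆ I) : cs.IsLeftReduced J x :=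
  fun i hi => h i (hJ hi)

theorem parabolic_mono (h : I ⊆ J) : cs.parabolic I ≤ cs.parabolic J :=
  Subgroup.closure_mono (Set.image_mono h)

theorem simple_mem_parabolic (hi : i ∈ I) : cs.simple i ∈ cs.parabolic I :=
  Subgroup.subset_closure ⟨i, hi, rfl⟩

theorem wordProd_mem_parabolic {ω : List B} (h : ∀ i ∈ ω, i ∈ I) :
    cs.wordProd ω ∈ cs.parabolic I := by
  induction ω with
  | nil => simp
  | cons i ω ih =>
    rw [wordProd_cons]
    exact Subgroup.mul_mem _ (simple_mem_parabolic (h i (by simp)))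
      (ih fun j hj => h j (by simp [hj]))

theorem exists_isReduced_of_mem_parabolic (h : a ∈ cs.parabolic I) :
    ∃ ω : List B, (∀ i ∈ ω, i ∈ I) ∧ cs.IsReduced ω ∧ cs.wordProd ω = a := by
  suffices h : ∃ ω : List B, (∀ i ∈ ω, i ∈ I) ∧ cs.wordProd ω = a by
    obtain ⟨ω, hω, rfl⟩ := h
    obtain ⟨μ, hsub, hred, he⟩ := cs.exists_isReduced_sublist ω
    exact ⟨μ, fun i hi => hω i (hsub.subset hi), hred, he⟩
  induction h using Subgroup.closure_induction with
  | mem x hx =>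
    obtain ⟨i, hi, rfl⟩ := hx
    exact ⟨[i], by simpa using hi, by simp⟩
  | one => exact ⟨[], by simp, by simp⟩
  | mul x y _ _ hx hy =>
    obtain ⟨ω, hω, rfl⟩ := hx
    obtain ⟨μ, hμ, rfl⟩ := hy
    refine ⟨ω ++ μ, ?_, cs.wordProd_append _ _⟩
    intro i hi
    rcases List.mem_append.1 hi with h | h
    exacts [hω i h, hμ i h]
  | inv x _ hx =>
    obtain ⟨ω, hω, rfl⟩ := hx
    exact ⟨ω.reverse, fun i hi => hω i (List.mem_reverse.1 hi), cs.wordProd_reverse _⟩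

/-- A nontrivial element of `W_I` has a right descent in `I`. -/
theorem exists_isRightDescent_of_mem_parabolic (h : a ∈ cs.parabolic I) (h1 : a ≠ 1) :
    ∃ i ∈ I, cs.IsRightDescent a i := by
  obtain ⟨ω, hω, hred, rfl⟩ := exists_isReduced_of_mem_parabolic h
  rcases List.eq_nil_or_concat ω with rfl | ⟨μ, i, rfl⟩
  · simp at h1
  · refine ⟨i, hω i (by simp), ?_⟩
    rw [IsRightDescent, hred.eq, wordProd_concat, simple_mul_simple_cancel_right]
    have := cs.length_wordProd_le μ
    simp only [List.length_concat]
    omega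

/-- If lengths first failed to add at some letter of a reduced word of `a`, exchange would delete a
letter either from the word of `x`, contradicting minimality in the coset, or from that of `a`,
contradicting reducedness. -/
theorem length_mul_of_minimal (hx : ∀ a ∈ cs.parabolic I, cs.length x ≤ cs.length (x * a))
    (ha : a ∈ cs.parabolic I) : cs.length (x * a) = cs.length x + cs.length a := by
  obtain ⟨ω, hω, hred, rfl⟩ := exists_isReduced_of_mem_parabolic ha
  obtain ⟨ν, hν, rfl⟩ := cs.exists_isReduced x
  clear ha
  induction ω using List.reverseRecOn with
  | nil => simp
  | append_singleton ω i ih =>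
    have hred' : cs.IsReduced ω := by simpa using hred.take ω.length
    have ih' := ih (fun j hj => hω j (by simp [hj])) hred'
    have hlast : cs.length (cs.wordProd (ω ++ [i])) = cs.length (cs.wordProd ω) + 1 := by
      rw [hred.eq, hred'.eq]; simp
    have hi : i ∈ I := hω i (by simp)
    have hωI : cs.wordProd ω ∈ cs.parabolic I :=
      wordProd_mem_parabolic fun j hj => hω j (by simp [hj])
    rw [hlast, wordProd_append, wordProd_singleton, ← mul_assoc, ← add_assoc, ← ih']
    by_contra hne
    have hd : cs.IsRightDescent (cs.wordProd (ν ++ ω)) i := by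
      by_contra h
      rw [not_isRightDescent_iff, wordProd_append] at h
      exact hne h
    obtain ⟨k, hk, he⟩ := cs.exists_eraseIdx_of_isRightDescent hd
    rcases lt_or_ge k ν.length with hkν | hkν
    · rw [List.eraseIdx_append_of_lt_length hkν, wordProd_append, wordProd_append] at he
      have h1 := hx (cs.wordProd ω * cs.simple i * (cs.wordProd ω)⁻¹)
        (mul_mem (mul_mem hωI (simple_mem_parabolic hi)) (inv_mem hωI))
      rw [show cs.wordProd ν * (cs.wordProd ω * cs.simple i * (cs.wordProd ω)⁻¹) =
        cs.wordProd ν * cs.wordProd ω * cs.simple i * (cs.wordProd ω)⁻¹ by group, he,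
        mul_inv_cancel_right, hν.eq] at h1
      have h2 := cs.length_wordProd_le (ν.eraseIdx k)
      rw [List.length_eraseIdx_of_lt hkν] at h2
      omega
    · rw [List.eraseIdx_append_of_length_le hkν, wordProd_append, wordProd_append, mul_assoc,
        mul_left_cancel_iff] at he
      rw [wordProd_append, wordProd_singleton, he] at hlast
      have h2 := cs.length_wordProd_le (ω.eraseIdx (k - ν.length))
      have hk' : k - ν.length < ω.length := by simp at hk; omega
      rw [List.length_eraseIdx_of_lt hk'] at h2
      rw [hred'.eq] at hlast
      omega

theorem exists_minimal_mul (w : W) (I : Set B) : ∃ x, ∃ a ∈ cs.parabolic I, w = x * a ∧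
    ∀ b ∈ cs.parabolic I, cs.length x ≤ cs.length (x * b) := by
  have hne : {n | ∃ b ∈ cs.parabolic I, cs.length (w * b) = n}.Nonempty :=
    ⟨_, 1, one_mem _, rfl⟩
  obtain ⟨b, hb, hmin⟩ := Nat.sInf_mem hne
  refine ⟨w * b, b⁻¹, inv_mem hb, by group, fun c hc => ?_⟩
  rw [hmin, mul_assoc]
  exact Nat.sInf_le ⟨b * c, mul_mem hb hc, rfl⟩

/-- The absence of descents in `I` already gives minimality in the coset: write `x = y b` with `y`
minimal; a descent of `b` in `I` would be one of `x`. -/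
theorem IsRightReduced.length_mul (hx : cs.IsRightReduced I x) (ha : a ∈ cs.parabolic I) :
    cs.length (x * a) = cs.length x + cs.length a := by
  refine length_mul_of_minimal ?_ ha
  obtain ⟨y, b, hb, rfl, hmin⟩ := cs.exists_minimal_mul x I
  have hb1 : b = 1 := by
    by_contra h1
    obtain ⟨i, hi, hd⟩ := exists_isRightDescent_of_mem_parabolic hb h1
    apply hx i hi
    rw [IsRightDescent, mul_assoc, length_mul_of_minimal hmin hb,
      length_mul_of_minimal hmin (mul_mem hb (simple_mem_parabolic hi))]
    exact Nat.add_lt_add_left hd _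
  simpa [hb1] using hmin

theorem IsLeftReduced.length_mul (hx : cs.IsLeftReduced I x) (ha : a ∈ cs.parabolic I) :
    cs.length (a * x) = cs.length a + cs.length x := by
  rw [← cs.length_inv, mul_inv_rev, (isRightReduced_inv_iff.2 hx).length_mul (inv_mem ha),
    cs.length_inv, cs.length_inv, add_comm]

theorem IsLeftReduced.eq_one_of_mul (hx : cs.IsLeftReduced I x) (ha : a ∈ cs.parabolic I)
    (hxa : cs.IsLeftReduced I (a * x)) : a = 1 := by
  have h1 := hx.length_mul ha
  have h2 := hxa.length_mul (inv_mem ha)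
  rw [inv_mul_cancel_left, cs.length_inv] at h2
  rw [← cs.length_eq_zero_iff]
  omega

theorem IsLeftReduced.of_mul (h : cs.IsLeftReduced I (x * b))
    (hlen : cs.length (x * b) = cs.length x + cs.length b) : cs.IsLeftReduced I x := by
  intro i hi hd
  apply h i hi
  have h1 := cs.length_mul_le (cs.simple i * x) b
  rw [IsLeftDescent] at *
  rw [mul_assoc] at h1
  omega

theorem IsRightReduced.of_mul (h : cs.IsRightReduced I (b * x))
    (hlen : cs.length (b * x) = cs.length b + cs.length x) : cs.IsRightReduced I x := by
  intro i hi hd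
  apply h i hi
  have h1 := cs.length_mul_le b (x * cs.simple i)
  rw [IsRightDescent] at *
  rw [← mul_assoc] at h1
  omega

theorem exists_isRightReduced_mul (cs : CoxeterSystem M W) (I : Set B) (w : W) :
    ∃ x, ∃ a ∈ cs.parabolic I, w = x * a ∧ cs.IsRightReduced I x := by
  obtain ⟨x, a, ha, hw, hmin⟩ := cs.exists_minimal_mul w I
  exact ⟨x, a, ha, hw, fun i hi => not_lt.2 (hmin _ (simple_mem_parabolic hi))⟩

theorem exists_mul_isLeftReduced (cs : CoxeterSystem M W) (I : Set B) (w : W) :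
    ∃ a ∈ cs.parabolic I, ∃ x, w = a * x ∧ cs.IsLeftReduced I x := by
  obtain ⟨x, a, ha, hw, hx⟩ := cs.exists_isRightReduced_mul I w⁻¹
  refine ⟨a⁻¹, inv_mem ha, x⁻¹, ?_, isLeftReduced_inv_iff.2 hx⟩
  rw [← mul_inv_rev, ← hw, inv_inv]

/-- Descents are stripped off on either side, each lowering the length by one; subadditivity then
makes the lengths add up. -/
theorem exists_double_reduced (cs : CoxeterSystem M W) (I J : Set B) (w : W) :
    ∃ a ∈ cs.parabolic I, ∃ x, ∃ b ∈ cs.parabolic J, w = a * x * b ∧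
      cs.IsLeftReduced I x ∧ cs.IsRightReduced J x ∧
      cs.length w = cs.length a + cs.length x + cs.length b := by
  induction hn : cs.length w using Nat.strong_induction_on generalizing w with
  | _ n ih =>
    subst hn
    by_cases hl : cs.IsLeftReduced I w
    · by_cases hr : cs.IsRightReduced J w
      · exact ⟨1, one_mem _, w, 1, one_mem _, by simp, hl, hr, by simp⟩
      · simp only [IsRightReduced, not_forall, not_not] at hr
        obtain ⟨j, hj, hd⟩ := hr
        obtain ⟨a, ha, x, b, hb, he, hxl, hxr, hlen⟩ := ih _ hd _ rfl
        have h1 := cs.isRightDescent_iff.1 hd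
        have hw : w = a * x * (b * cs.simple j) := by
          rw [← mul_assoc, ← he, simple_mul_simple_cancel_right]
        refine ⟨a, ha, x, b * cs.simple j, mul_mem hb (simple_mem_parabolic hj), hw, hxl, hxr, ?_⟩
        have h2 := cs.length_mul_le b (cs.simple j)
        have h3 := cs.length_mul_le (a * x) (b * cs.simple j)
        have h4 := cs.length_mul_le a x
        rw [← hw] at h3
        rw [length_simple] at h2
        omega
    · simp only [IsLeftReduced, not_forall, not_not] at hl
      obtain ⟨i, hi, hd⟩ := hl
      obtain ⟨a, ha, x, b, hb, he, hxl, hxr, hlen⟩ := ih _ hd _ rfl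
      have h1 := cs.isLeftDescent_iff.1 hd
      have hw : w = cs.simple i * a * x * b := by
        rw [mul_assoc (cs.simple i), mul_assoc (cs.simple i), ← he, simple_mul_simple_cancel_left]
      refine ⟨cs.simple i * a, mul_mem (simple_mem_parabolic hi) ha, x, b, hb, hw, hxl, hxr, ?_⟩
      have h2 := cs.length_mul_le (cs.simple i) a
      have h3 := cs.length_mul_le (cs.simple i * a * x) b
      have h4 := cs.length_mul_le (cs.simple i * a) x
      rw [← hw] at h3
      rw [length_simple] at h2
      omega

/-- Take a reduced subword of the concatenated words of `a`, `y`, `b`. A letter surviving from `a`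
would produce a left descent of `x` in `I`, one from `b` a right descent in `J`, so only letters
from `y` remain. -/
theorem mem_parabolic_of_double_reduced (hl : cs.IsLeftReduced I x) (hr : cs.IsRightReduced J x)
    (ha : a ∈ cs.parabolic I) (hy : y ∈ cs.parabolic K) (hb : b ∈ cs.parabolic J)
    (h : x = a * y * b) : x ∈ cs.parabolic K := by
  obtain ⟨α, hα, -, rfl⟩ := exists_isReduced_of_mem_parabolic ha
  obtain ⟨β, hβ, -, rfl⟩ := exists_isReduced_of_mem_parabolic hb
  obtain ⟨υ, hυ, -, rfl⟩ := exists_isReduced_of_mem_parabolic hy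
  rw [← wordProd_append, ← wordProd_append] at h
  obtain ⟨μ, hsub, hred, he⟩ := cs.exists_isReduced_sublist (α ++ υ ++ β)
  obtain ⟨μ', μ₃, rfl, hsub', h3⟩ := List.sublist_append_iff.1 hsub
  obtain ⟨μ₁, μ₂, rfl, h1, h2⟩ := List.sublist_append_iff.1 hsub'
  rw [← he] at h
  have e1 : μ₁ = [] := by
    rcases μ₁ with _ | ⟨i, μ₁⟩
    · rfl
    · exfalso
      apply hl i (hα i (h1.subset (by simp)))
      rw [IsLeftDescent, h, hred.eq]
      simp only [List.cons_append, wordProd_cons, simple_mul_simple_cancel_left]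
      have := cs.length_wordProd_le (μ₁ ++ μ₂ ++ μ₃)
      simp only [List.length_cons]
      omega
  have e3 : μ₃ = [] := by
    rcases List.eq_nil_or_concat μ₃ with rfl | ⟨μ₃, i, rfl⟩
    · rfl
    · exfalso
      apply hr i (hβ i (h3.subset (by simp)))
      rw [IsRightDescent, h, hred.eq]
      rw [List.concat_eq_append, ← List.append_assoc, ← List.concat_eq_append, wordProd_concat,
        simple_mul_simple_cancel_right]
      have := cs.length_wordProd_le (μ₁ ++ μ₂ ++ μ₃)
      simp only [List.length_concat]
      omega
  rw [h, e1, e3]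
  simpa using wordProd_mem_parabolic fun i hi => hυ i (h2.subset hi)

/-- The folding property. -/
theorem simple_mul_eq_mul_simple (hl : ¬ cs.IsLeftDescent w i) (hr : ¬ cs.IsRightDescent w j)
    (h : cs.length (cs.simple i * w * cs.simple j) < cs.length (w * cs.simple j)) :
    cs.simple i * w = w * cs.simple j := by
  obtain ⟨ω, hω, rfl⟩ := cs.exists_isReduced w
  rw [not_isLeftDescent_iff] at hl
  rw [not_isRightDescent_iff] at hr
  have hp : cs.wordProd (i :: ω) = cs.simple i * cs.wordProd ω := cs.wordProd_cons _ _
  have hd : cs.IsRightDescent (cs.wordProd (i :: ω)) j := by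
    rw [hp, IsRightDescent]; omega
  obtain ⟨k, hk, he⟩ := cs.exists_eraseIdx_of_isRightDescent hd
  -- Deleting the leading `i` gives the claim; deleting any other letter would make `w s_j` too
  -- short.
  rcases k with _ | k
  · rw [hp, List.eraseIdx_zero, List.tail_cons] at he
    simpa using congrArg (· * cs.simple j) he
  · exfalso
    rw [hp, List.eraseIdx_cons_succ, wordProd_cons, mul_assoc, mul_left_cancel_iff] at he
    rw [he] at hr
    have h2 := cs.length_wordProd_le (ω.eraseIdx k)
    rw [List.length_eraseIdx_of_lt (by simpa using hk)] at h2
    rw [hω.eq] at hr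
    omega

/-- Deodhar's lemma. -/
theorem IsRightReduced.simple_mul (hx : cs.IsRightReduced I x) (i : B) :
    cs.IsRightReduced I (cs.simple i * x) ∨ ∃ j ∈ I, cs.simple i * x = x * cs.simple j := by
  by_cases h : cs.IsRightReduced I (cs.simple i * x)
  · exact Or.inl h
  · right
    simp only [IsRightReduced, not_forall, not_not] at h
    obtain ⟨j, hj, hd⟩ := h
    have h1 := cs.not_isRightDescent_iff.1 (hx j hj)
    have h2 := cs.isRightDescent_iff.1 hd
    have h3 := cs.length_simple_mul (x * cs.simple j) i
    have h4 := cs.length_simple_mul x i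
    rw [← mul_assoc] at h3
    refine ⟨j, hj, simple_mul_eq_mul_simple (fun h => ?_) (hx j hj) (by omega)⟩
    rw [isLeftDescent_iff] at h
    omega

theorem IsLeftReduced.mul_simple (hx : cs.IsLeftReduced I x) (i : B) :
    cs.IsLeftReduced I (x * cs.simple i) ∨ ∃ j ∈ I, x * cs.simple i = cs.simple j * x := by
  rcases (isRightReduced_inv_iff.2 hx).simple_mul i with h | ⟨j, hj, h⟩
  · left
    rw [← isRightReduced_inv_iff, mul_inv_rev, inv_simple]
    exact h
  · right
    refine ⟨j, hj, ?_⟩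
    have := congrArg (·⁻¹) h
    simpa using this

theorem commute_of_mem_parabolic
    (hc : ∀ i ∈ I, ∀ j ∈ J, cs.simple i * cs.simple j = cs.simple j * cs.simple i)
    (ha : a ∈ cs.parabolic I) (hb : b ∈ cs.parabolic J) : a * b = b * a := by
  have h1 : cs.parabolic I ≤ Subgroup.centralizer (cs.simple '' J) := by
    rw [parabolic, Subgroup.closure_le]
    rintro _ ⟨i, hi, rfl⟩
    rw [SetLike.mem_coe, Subgroup.mem_centralizer_iff]
    rintro _ ⟨j, hj, rfl⟩
    exact (hc i hi j hj).symm
  have h2 : cs.parabolic J ≤ Subgroup.centralizer {a} := by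
    rw [parabolic, Subgroup.closure_le]
    rintro _ ⟨j, hj, rfl⟩
    rw [SetLike.mem_coe, Subgroup.mem_centralizer_iff]
    rintro _ rfl
    exact ((Subgroup.mem_centralizer_iff.1 (h1 ha)) _ ⟨j, hj, rfl⟩).symm
  exact (Subgroup.mem_centralizer_iff.1 (h2 hb)) a rfl

/-- Append `s_k`, `k ∈ J`, to `y` and suppose `i ∈ I` becomes a descent. If `s_k` lengthens `y`,
then `y` is reduced for `{i, k}` and `s_k s_i` must have length zero. If it shortens `y`, then `y
s_i s_k = y s_k s_i` is too short, because `s_i` lengthens `y`. -/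
theorem IsRightReduced.mul_of_commute (hx : cs.IsRightReduced I x)
    (hc : ∀ i ∈ I, ∀ j ∈ J, cs.simple i * cs.simple j = cs.simple j * cs.simple i)
    (hne : ∀ i ∈ I, ∀ j ∈ J, cs.simple i ≠ cs.simple j) (ha : a ∈ cs.parabolic J) :
    cs.IsRightReduced I (x * a) := by
  obtain ⟨ω, hω, -, rfl⟩ := exists_isReduced_of_mem_parabolic ha
  clear ha
  induction ω using List.reverseRecOn with
  | nil => simpa using hx
  | append_singleton ω k ih =>
    have ih' := ih fun j hj => hω j (by simp [hj])
    have hk : k ∈ J := hω k (by simp)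
    rw [wordProd_append, wordProd_singleton, ← mul_assoc]
    generalize x * cs.wordProd ω = y at *
    intro i hi hd
    have h0 := cs.not_isRightDescent_iff.1 (ih' i hi)
    have h1 := cs.isRightDescent_iff.1 hd
    have h2 : y * cs.simple k * cs.simple i = y * cs.simple i * cs.simple k := by
      rw [mul_assoc, mul_assoc, hc i hi k hk]
    have h3 := cs.length_mul_simple (y * cs.simple i) k
    rw [← h2] at h3
    rcases cs.length_mul_simple y k with h4 | h4
    · have hy : cs.IsRightReduced {i, k} y := by
        intro l hl
        rcases hl with rfl | rfl
        · exact ih' _ hi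
        · rw [not_isRightDescent_iff]; exact h4
      have h5 := hy.length_mul (a := cs.simple k * cs.simple i)
        (mul_mem (simple_mem_parabolic (by simp)) (simple_mem_parabolic (by simp)))
      rw [← mul_assoc] at h5
      have h6 : cs.length (cs.simple k * cs.simple i) = 0 := by omega
      rw [length_eq_zero_iff] at h6
      apply hne i hi k hk
      rw [← cs.inv_simple k]
      exact (inv_eq_of_mul_eq_one_right h6).symm
    · omega

theorem IsLeftReduced.mul_of_commute (hx : cs.IsLeftReduced I x)
    (hc : ∀ i ∈ I, ∀ j ∈ J, cs.simple i * cs.simple j = cs.simple j * cs.simple i)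
    (hne : ∀ i ∈ I, ∀ j ∈ J, cs.simple i ≠ cs.simple j) (ha : a ∈ cs.parabolic J) :
    cs.IsLeftReduced I (a * x) := by
  rw [← isRightReduced_inv_iff, mul_inv_rev]
  exact (isRightReduced_inv_iff.2 hx).mul_of_commute hc hne (inv_mem ha)

end CoxeterSystem

/-! ### Centralizers and fixers of idempotents, and products `f x e`. -/

namespace RennerCoxeter

section Types

variable {R : Type*} [Monoid R] {B : Type*} {M : CoxeterMatrix B} (cs : CoxeterSystem M Rˣ)

/-- The indices of the simple reflections that commute with `e`. -/
def commType (e : R) : Set B := {i | cs.simple i ∈ centralizer e}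

/-- The indices of the simple reflections that fix `e`. -/
def fixType (e : R) : Set B := {i | cs.simple i ∈ fixer e}

/-- The indices of the simple reflections that commute with `e` and do not fix it. -/
def moveType (e : R) : Set B := commType cs e \ fixType cs e

theorem fixer_le_centralizer (e : R) : fixer e ≤ centralizer e :=
  fun _ hw => hw.1.trans hw.2.symm

theorem fixType_subset (e : R) : fixType cs e ⊆ commType cs e :=
  fun _ hi => fixer_le_centralizer e hi

theorem conj_mem_fixer {e : R} {a b : Rˣ} (ha : a ∈ centralizer e) (hb : b ∈ fixer e) :
    a * b * a⁻¹ ∈ fixer e := by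
  have ha' : ((a⁻¹ : Rˣ) : R) * e = e * ((a⁻¹ : Rˣ) : R) := inv_mem ha
  have ha : (a : R) * e = e * a := ha
  constructor
  · rw [Units.val_mul, Units.val_mul, mul_assoc, ha', ← mul_assoc, mul_assoc (a : R), hb.1, ha,
      mul_assoc, Units.mul_inv, mul_one]
  · rw [Units.val_mul, Units.val_mul, ← mul_assoc, ← mul_assoc, ← ha, mul_assoc (a : R), hb.2, ha,
      mul_assoc, Units.mul_inv, mul_one]

theorem IsStandardParabolic.eq_parabolic {S : Set Rˣ} {M : CoxeterMatrix S}
    {cs : CoxeterSystem M Rˣ} (hcs : ∀ s : S, cs.simple s = s) {H : Subgroup Rˣ}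
    (hH : IsStandardParabolic S H) : H = cs.parabolic {i | cs.simple i ∈ H} := by
  obtain ⟨I, hI, rfl⟩ := hH
  apply le_antisymm
  · rw [Subgroup.closure_le]
    intro s hs
    have := CoxeterSystem.simple_mem_parabolic (cs := cs)
      (I := {i | cs.simple i ∈ Subgroup.closure I}) (i := ⟨s, hI hs⟩)
      (by rw [Set.mem_ofPred_eq, hcs]; exact Subgroup.subset_closure hs)
    rwa [hcs] at this
  · rw [CoxeterSystem.parabolic, Subgroup.closure_le]
    rintro _ ⟨i, hi, rfl⟩
    exact hi

end Types

section System

variable {R : Type*} [Monoid R] {Λ : Set R} {S : Set Rˣ} {M : CoxeterMatrix S}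
  {cs : CoxeterSystem M Rˣ}

theorem conj_one (e : R) : conj 1 e = e := by simp [conj]

theorem conj_mul (v w : Rˣ) (e : R) : conj (v * w) e = conj v (conj w e) := by
  simp [conj, mul_assoc]

theorem conj_inv_of_eq {w : Rˣ} {e f : R} (h : conj w e = f) : conj w⁻¹ f = e := by
  rw [← h, ← conj_mul, inv_mul_cancel, conj_one]

theorem mem_centralizer_of_conj {w : Rˣ} {e : R} (h : conj w e = e) : w ∈ centralizer e := by
  change (w : R) * e = e * w
  rw [conj, Units.mul_inv_eq_iff_eq_mul] at h
  exact h

theorem isIdempotentElem_conj {e : R} (he : IsIdempotentElem e) (w : Rˣ) :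
    IsIdempotentElem (conj w e) := by
  rw [IsIdempotentElem, conj]
  calc (w : R) * e * ((w⁻¹ : Rˣ) : R) * (w * e * ((w⁻¹ : Rˣ) : R))
      = w * (e * (((w⁻¹ : Rˣ) : R) * w) * e) * ((w⁻¹ : Rˣ) : R) := by simp only [mul_assoc]
    _ = _ := by rw [Units.inv_mul, mul_one, he.eq]

theorem mul_mul_unit_of_mem_fixer {e : R} {a : Rˣ} (ha : a ∈ fixer e) (w v : Rˣ) :
    ((w * a : Rˣ) : R) * e * v = w * e * v := by
  rw [Units.val_mul, mul_assoc (w : R), ha.1]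

theorem mul_unit_mul_of_mem_fixer {e : R} {a : Rˣ} (ha : a ∈ fixer e) (w v : Rˣ) :
    (w : R) * e * ((a * v : Rˣ) : R) = w * e * v := by
  rw [Units.val_mul, ← mul_assoc, mul_assoc (w : R), ha.2]

theorem mul_mul_unit_comm {e : R} {a : Rˣ} (ha : a ∈ centralizer e) (w v : Rˣ) :
    ((w * a : Rˣ) : R) * e * v = w * e * ((a * v : Rˣ) : R) := by
  have ha : (a : R) * e = e * a := ha
  rw [Units.val_mul, mul_assoc (w : R), ha, Units.val_mul]
  simp only [mul_assoc]

namespace IsSystem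

variable (h : IsSystem Λ S) (hcs : ∀ s : S, cs.simple s = s)

include h

theorem eq_of_conj_eq {e f : R} (he : e ∈ Λ) (hf : f ∈ Λ) {w : Rˣ} (hw : conj w e = f) :
    e = f := by
  obtain ⟨g, -, hg⟩ := h.transversal e (h.idem_of_mem e he)
  rw [hg e ⟨he, 1, conj_one e⟩, hg f ⟨hf, w, hw⟩]

theorem one_mem : (1 : R) ∈ Λ := by
  obtain ⟨g, ⟨hg, w, hw⟩, -⟩ := h.transversal 1 (by simp [IsIdempotentElem])
  rw [conj, mul_one, Units.mul_inv] at hw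
  rwa [hw]

/-- From `e u = e`, the conjugate `u⁻¹ e u` equals `u⁻¹ e`; that this idempotent commutes with `e`
gives `u⁻¹ e = e`. -/
theorem mem_fixer_of_mul_eq {e : R} (he : IsIdempotentElem e) {u : Rˣ} (hu : e * u = e) :
    u ∈ fixer e := by
  have hu' : e * ((u⁻¹ : Rˣ) : R) = e := by rw [Units.mul_inv_eq_iff_eq_mul, hu]
  have hc : conj u⁻¹ e = ((u⁻¹ : Rˣ) : R) * e := by rw [conj, inv_inv, mul_assoc, hu]
  have hcomm := h.factorisable.idem_comm _ _ he (isIdempotentElem_conj he u⁻¹)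
  rw [hc, ← mul_assoc, hu', he.eq, mul_assoc, he.eq] at hcomm
  exact ⟨by rw [← Units.eq_inv_mul_iff_mul_eq]; exact hcomm, hu⟩

/-- Write `e = c u` with `c` a conjugate of `f` and `u` a unit. Then `c e = e` and `e c = c`, so
commuting idempotents give `c = e`, and the transversal property gives `e = f`. -/
theorem eq_of_mul_mul_eq {e f : R} (he : e ∈ Λ) (hf : f ∈ Λ) {w₁ w₂ v₁ v₂ : Rˣ}
    (heq : (w₁ : R) * e * w₂ = v₁ * f * v₂) :
    e = f ∧ w₁⁻¹ * v₁ ∈ centralizer e ∧ w₁⁻¹ * v₁ * (v₂ * w₂⁻¹) ∈ fixer e := by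
  have hei := h.idem_of_mem e he
  have hfi := h.idem_of_mem f hf
  set a := w₁⁻¹ * v₁ with ha
  set b := v₂ * w₂⁻¹ with hb
  have h1 : e = a * f * b := by
    have : e = ((w₁⁻¹ : Rˣ) : R) * (w₁ * e * w₂) * ((w₂⁻¹ : Rˣ) : R) := by simp [mul_assoc]
    rw [this, heq, ha, hb]
    simp [mul_assoc]
  clear_value a b
  have h2 : e = conj a f * ((a * b : Rˣ) : R) := by
    rw [conj, Units.val_mul, ← mul_assoc, mul_assoc _ _ (a : R), Units.inv_mul, mul_one, h1]
  have hci := isIdempotentElem_conj hfi a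
  have h3 : conj a f * e = e := by
    conv_lhs => rw [h2]
    rw [← mul_assoc, hci.eq, ← h2]
  have h4 : e * conj a f = conj a f := by
    have : conj a f = e * (((a * b)⁻¹ : Rˣ) : R) := by
      rw [Units.eq_mul_inv_iff_mul_eq, ← h2]
    rw [this, ← mul_assoc, hei.eq]
  have h5 : conj a f = e := by
    rw [← h4, h.factorisable.idem_comm _ _ hei hci, h3]
  have hfe := h.eq_of_conj_eq hf he h5
  subst hfe
  refine ⟨rfl, mem_centralizer_of_conj h5, h.mem_fixer_of_mul_eq hei ?_⟩
  rw [h5] at h2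
  exact h2.symm

include hcs

theorem centralizer_eq {e : R} (he : e ∈ Λ) : centralizer e = cs.parabolic (commType cs e) :=
  (h.parabolic_centralizer e he).eq_parabolic hcs

theorem fixer_eq {e : R} (he : e ∈ Λ) : fixer e = cs.parabolic (fixType cs e) :=
  (h.parabolic_fixer e he).eq_parabolic hcs

theorem moveType_mono {e f : R} (he : e ∈ Λ) (hf : f ∈ Λ) (hle : IdemLE e f) :
    moveType cs e ⊆ moveType cs f := by
  have key : ∀ (g : R) (i : S), i ∈ moveType cs g ↔ (i : Rˣ) ∈ upperType S g := by
    intro g i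
    have hi : ∀ H : Subgroup Rˣ, cs.simple i ∈ H ↔ (i : Rˣ) ∈ H := fun H => by rw [hcs]
    simp only [moveType, commType, fixType, Set.mem_sdiff, Set.mem_ofPred_eq, hi, upperType]
    constructor
    · rintro ⟨h1, h2⟩
      have h1' : ((i : Rˣ) : R) * g = g * (i : Rˣ) := h1
      exact ⟨i.2, h1', fun h3 => h2 ⟨h1'.trans h3, h3⟩⟩
    · rintro ⟨-, h1, h2⟩
      exact ⟨h1, fun h3 => h2 h3.2⟩
  intro i hi
  rw [key] at *
  exact h.upperType_mono e he f hf hle hi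

omit h hcs in
theorem simple_ne_simple {e : R} {i j : S} (hi : i ∈ fixType cs e) (hj : j ∈ moveType cs e) :
    cs.simple i ≠ cs.simple j := by
  intro he
  apply hj.2
  change cs.simple j ∈ fixer e
  rw [← he]
  exact hi

/-- By normality of `W_⋆(e)` in `W(e)`, the conjugate `s_j s_i s_j` lies in `W_⋆(e)`. Comparing
lengths in `(s_j s_i s_j) s_j = s_j s_i` shows that it has length one, so it is `s_i` or `s_j`; but
`s_j` is not in `W_⋆(e)`. -/
theorem simple_mul_simple_comm {e : R} (he : e ∈ Λ) {i j : S} (hi : i ∈ fixType cs e)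
    (hj : j ∈ moveType cs e) : cs.simple i * cs.simple j = cs.simple j * cs.simple i := by
  have hmem : cs.simple j * cs.simple i * (cs.simple j)⁻¹ ∈ cs.parabolic (fixType cs e) := by
    rw [← h.fixer_eq hcs he]
    exact conj_mem_fixer hj.1 hi
  rw [cs.inv_simple] at hmem
  have hne : cs.simple j ∉ cs.parabolic (fixType cs e) := by
    rw [← h.fixer_eq hcs he]
    exact hj.2
  have hred : cs.IsRightReduced (fixType cs e) (cs.simple j) := by
    intro k hk hd
    rw [CoxeterSystem.IsRightDescent, cs.length_simple, Nat.lt_one_iff,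
      cs.length_eq_zero_iff] at hd
    apply simple_ne_simple hk hj
    rw [← cs.inv_simple j]
    exact (inv_eq_of_mul_eq_one_right hd).symm
  have hred' : cs.IsLeftReduced (fixType cs e) (cs.simple j) := by
    rw [← CoxeterSystem.isRightReduced_inv_iff, cs.inv_simple]
    exact hred
  have h1 := hred'.length_mul hmem
  rw [cs.simple_mul_simple_cancel_right,
    hred.length_mul (CoxeterSystem.simple_mem_parabolic hi), cs.length_simple,
    cs.length_simple] at h1
  obtain ⟨ω, hω, hr, hp⟩ := CoxeterSystem.exists_isReduced_of_mem_parabolic hmem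
  obtain ⟨μ, hsub, hμ, hp'⟩ := cs.exists_isReduced_sublist [j, i, j]
  have hp'' : cs.wordProd [j, i, j] = cs.simple j * cs.simple i * cs.simple j := by
    simp [cs.wordProd_cons, mul_assoc]
  have hlen := hμ.eq
  rw [hp', hp''] at hlen
  obtain ⟨k, rfl⟩ := List.length_eq_one_iff.1 (show μ.length = 1 by omega)
  rw [hp'', cs.wordProd_singleton] at hp'
  have hk : k = j ∨ k = i := by
    have := hsub.subset (List.mem_singleton_self k)
    simpa [or_comm, or_assoc, or_left_comm] using this
  rcases hk with rfl | rfl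
  · exact absurd (hp' ▸ hmem) hne
  · have := congrArg (cs.simple j * ·) hp'
    simp only [mul_assoc, cs.simple_mul_simple_cancel_left] at this
    exact this.symm

theorem mul_comm_of_mem {e : R} (he : e ∈ Λ) {a b : Rˣ} (ha : a ∈ fixer e)
    (hb : b ∈ cs.parabolic (moveType cs e)) : a * b = b * a := by
  rw [h.fixer_eq hcs he] at ha
  exact CoxeterSystem.commute_of_mem_parabolic
    (fun i hi j hj => h.simple_mul_simple_comm hcs he hi hj) ha hb

theorem isRightReduced_mul {e : R} (he : e ∈ Λ) {x b : Rˣ}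
    (hx : cs.IsRightReduced (fixType cs e) x) (hb : b ∈ cs.parabolic (moveType cs e)) :
    cs.IsRightReduced (fixType cs e) (x * b) :=
  hx.mul_of_commute (fun _ hi _ hj => h.simple_mul_simple_comm hcs he hi hj)
    (fun _ hi _ hj => simple_ne_simple hi hj) hb

theorem isLeftReduced_mul {e : R} (he : e ∈ Λ) {x b : Rˣ}
    (hx : cs.IsLeftReduced (fixType cs e) x) (hb : b ∈ cs.parabolic (moveType cs e)) :
    cs.IsLeftReduced (fixType cs e) (b * x) :=
  hx.mul_of_commute (fun _ hi _ hj => h.simple_mul_simple_comm hcs he hi hj)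
    (fun _ hi _ hj => simple_ne_simple hi hj) hb

theorem parabolic_moveType_le {e : R} (he : e ∈ Λ) :
    cs.parabolic (moveType cs e) ≤ centralizer e := by
  rw [h.centralizer_eq hcs he]
  exact CoxeterSystem.parabolic_mono Set.sdiff_subset

/-- The simple reflections of `W(e)` either fix `e` or not, and the two kinds commute, so `W(e) =
W^⋆(e) W_⋆(e)`. -/
theorem exists_eq_mul_of_mem_centralizer {e : R} (he : e ∈ Λ) {a : Rˣ} (ha : a ∈ centralizer e) :
    ∃ c ∈ cs.parabolic (moveType cs e), ∃ b ∈ fixer e, a = c * b := by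
  rw [h.centralizer_eq hcs he] at ha
  obtain ⟨ω, hω, -, rfl⟩ := CoxeterSystem.exists_isReduced_of_mem_parabolic ha
  clear ha
  induction ω with
  | nil => exact ⟨1, Subgroup.one_mem _, 1, Subgroup.one_mem _, by simp⟩
  | cons i ω ih =>
    obtain ⟨c, hc, b, hb, hcb⟩ := ih fun j hj => hω j (by simp [hj])
    rw [cs.wordProd_cons, hcb]
    by_cases hi : i ∈ fixType cs e
    · refine ⟨c, hc, cs.simple i * b, Subgroup.mul_mem _ hi hb, ?_⟩
      rw [← mul_assoc, h.mul_comm_of_mem hcs he hi hc, mul_assoc]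
    · exact ⟨cs.simple i * c, Subgroup.mul_mem _
        (CoxeterSystem.simple_mem_parabolic ⟨hω i (by simp), hi⟩) hc, b, hb, (mul_assoc _ _ _).symm⟩

theorem length_mul_of_mem {e : R} (he : e ∈ Λ) {c b : Rˣ}
    (hc : c ∈ cs.parabolic (moveType cs e)) (hb : b ∈ fixer e) :
    cs.length (c * b) = cs.length c + cs.length b := by
  rw [h.fixer_eq hcs he] at hb
  have h1 : cs.IsRightReduced (fixType cs e) 1 := fun i _ => cs.not_isRightDescent_one i
  have h2 := h.isRightReduced_mul hcs he h1 hc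
  rw [one_mul] at h2
  exact h2.length_mul hb

/-- The idempotent `p = f · x e x⁻¹` lies below `f` and below `x e x⁻¹`. Applying `conj_pair` to
both pairs yields one `g ∈ Λ` with `p = v g v⁻¹ = u g u⁻¹`, where `v ∈ W(f)` and `x⁻¹ u ∈ W(e)`.
Split `v⁻¹ u ∈ W(g)` as `c b` with `c ∈ W^⋆(g)`, `b ∈ W_⋆(g)`; by `upperType_mono`, `c` lies in
`W(f)`. So `x ∈ W(f) W_⋆(g) W(e)`, and being doubly reduced it lies in `W_⋆(g)`. -/
theorem mul_mul_eq_of_reduced {e f : R} (he : e ∈ Λ) (hf : f ∈ Λ) {x : Rˣ}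
    (hl : cs.IsLeftReduced (commType cs f) x) (hr : cs.IsRightReduced (commType cs e) x) :
    ∃ g ∈ Λ, f * x * e = g ∧ IdemLE g f ∧ IdemLE g e ∧ x ∈ fixer g := by
  have hei := h.idem_of_mem e he
  have hfi := h.idem_of_mem f hf
  have hci := isIdempotentElem_conj hei x
  have hcomm := h.factorisable.idem_comm _ _ hfi hci
  set p := f * conj x e with hp
  have hpi : IsIdempotentElem p := by
    change f * conj x e * (f * conj x e) = f * conj x e
    rw [mul_assoc, ← mul_assoc (conj x e), ← hcomm, mul_assoc f, hci.eq, ← mul_assoc, hfi.eq]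
  have hpf : IdemLE p f := by
    have : f * p = p := by rw [hp, ← mul_assoc, hfi.eq]
    exact ⟨(h.factorisable.idem_comm _ _ hpi hfi).trans this, this⟩
  have hpe : IdemLE p (conj x e) := by
    have : p * conj x e = p := by rw [hp, mul_assoc, hci.eq]
    exact ⟨this, (h.factorisable.idem_comm _ _ hci hpi).trans this⟩
  obtain ⟨v, g, f', hg, hf', hgf, hvg, hvf⟩ := h.conj_pair p f hpi hfi hpf
  obtain ⟨u, g', e', hg', he', hge, hug, hue⟩ := h.conj_pair p (conj x e) hpi hci hpe
  obtain rfl := h.eq_of_conj_eq hf' hf hvf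
  have hxu : conj (x⁻¹ * u) e' = e := by
    rw [conj_mul, hue, ← conj_mul, inv_mul_cancel, conj_one]
  obtain rfl := h.eq_of_conj_eq he' he hxu
  have hvu : conj (v⁻¹ * u) g' = g := by rw [conj_mul, hug, conj_inv_of_eq hvg]
  obtain rfl := h.eq_of_conj_eq hg' hg hvu
  have hx : x ∈ fixer g' := by
    obtain ⟨c, hc, b, hb, hcb⟩ :=
      h.exists_eq_mul_of_mem_centralizer hcs hg (mem_centralizer_of_conj hvu)
    have hc' : c ∈ centralizer f' := h.parabolic_moveType_le hcs hf
      (CoxeterSystem.parabolic_mono (h.moveType_mono hcs hg hf hgf) hc)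
    have hvc : v * c ∈ cs.parabolic (commType cs f') := by
      rw [← h.centralizer_eq hcs hf]
      exact Subgroup.mul_mem _ (mem_centralizer_of_conj hvf) hc'
    have hxu' : (x⁻¹ * u)⁻¹ ∈ cs.parabolic (commType cs e') := by
      rw [← h.centralizer_eq hcs he]
      exact Subgroup.inv_mem _ (mem_centralizer_of_conj hxu)
    rw [h.fixer_eq hcs hg] at hb ⊢
    refine CoxeterSystem.mem_parabolic_of_double_reduced hl hr hvc hb hxu' ?_
    rw [mul_assoc v, ← hcb]
    group
  refine ⟨g', hg, ?_, hgf, hge, hx⟩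
  have hx' : g' * ((x⁻¹ : Rˣ) : R) = g' := (Subgroup.inv_mem _ hx).2
  have hgi := h.idem_of_mem g' hg
  have hgp : g' * p = g' := by
    rw [hp, ← mul_assoc, hgf.1, conj, ← mul_assoc, ← mul_assoc, hx.2, hge.1, hx']
  -- The idempotents `g' ≤ p` are conjugate. The pair in `Λ` supplied by `conj_pair` is therefore
  -- `(g', g')`, and a single unit carries it to `(g', p)`, whence `p = g'`.
  obtain ⟨w, g₁, g₂, hg₁, hg₂, -, hw₁, hw₂⟩ := h.conj_pair g' p hgi hpi
    ⟨hgp, (h.factorisable.idem_comm _ _ hpi hgi).trans hgp⟩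
  have e1 := h.eq_of_conj_eq hg₁ hg hw₁
  have e2 : g₂ = g' := h.eq_of_conj_eq (w := u⁻¹ * w) hg₂ hg (by
    rw [conj_mul, hw₂, conj_inv_of_eq hug])
  rw [e1] at hw₁
  rw [e2, hw₁] at hw₂
  have : f' * x * e' = p * x := by
    rw [hp, conj, mul_assoc f', mul_assoc f', mul_assoc (_ * _), Units.inv_mul, mul_one]
  rw [this, ← hw₂, hx.2]

end IsSystem

end System

end RennerCoxeter

/-! ### Normal forms and the length function. -/

namespace RennerCoxeter

section Length

variable {R : Type*} [Monoid R] {Λ : Set R} {S : Set Rˣ} {M : CoxeterMatrix S}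
  {cs : CoxeterSystem M Rˣ}

theorem wordVal_append (ω ω' : List (Letter Λ S)) :
    wordVal (ω ++ ω') = wordVal ω * wordVal ω' := by simp [wordVal]

theorem wordLen_append (ω ω' : List (Letter Λ S)) :
    wordLen (ω ++ ω') = wordLen ω + wordLen ω' := by simp [wordLen]

theorem wordVal_cons (x : Letter Λ S) (ω : List (Letter Λ S)) :
    wordVal (x :: ω) = x.val * wordVal ω := by simp [wordVal]

theorem wordLen_cons (x : Letter Λ S) (ω : List (Letter Λ S)) :
    wordLen (x :: ω) = x.len + wordLen ω := by simp [wordLen]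

theorem length_wordVal_le (ω : List (Letter Λ S)) : length Λ S (wordVal ω) ≤ wordLen ω :=
  Nat.sInf_le ⟨ω, rfl, rfl⟩

theorem length_mem_le {e : R} (he : e ∈ Λ) : length Λ S e = 0 := by
  rw [← Nat.le_zero]
  by_cases h1 : e = 1
  · simpa [wordVal, wordLen, h1] using length_wordVal_le (Λ := Λ) (S := S) []
  · simpa [wordVal, wordLen, Letter.val, Letter.len] using
      length_wordVal_le (Λ := Λ) (S := S) [Sum.inr ⟨e, he, h1⟩]

theorem length_one_eq : length Λ S (1 : R) = 0 := by
  simpa [wordVal, wordLen] using length_wordVal_le (Λ := Λ) (S := S) []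

theorem length_unit_le (hcs : ∀ s : S, cs.simple s = s) (u : Rˣ) :
    length Λ S (u : R) ≤ cs.length u := by
  obtain ⟨l, hl, rfl⟩ := cs.exists_isReduced u
  rw [hl.eq]
  have hv : wordVal (Λ := Λ) (l.map Sum.inl) = ((cs.wordProd l : Rˣ) : R) := by
    clear hl
    induction l with
    | nil => simp [wordVal]
    | cons i l ih => rw [List.map_cons, wordVal_cons, ih, cs.wordProd_cons, hcs]; rfl
  have hlen : wordLen (Λ := Λ) (S := S) (l.map Sum.inl) = l.length := by
    clear hl hv
    induction l with
    | nil => simp [wordLen]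
    | cons i l ih => rw [List.map_cons, wordLen_cons, ih, List.length_cons, add_comm]; rfl
  rw [← hv, ← hlen]
  exact length_wordVal_le _

namespace IsSystem

variable (h : IsSystem Λ S) (hcs : ∀ s : S, cs.simple s = s)

include h

theorem exists_minimal_word (r : R) :
    ∃ ω : List (Letter Λ S), wordVal ω = r ∧ wordLen ω = length Λ S r := by
  obtain ⟨ω₀, h₀⟩ := h.exists_word r
  exact Nat.sInf_mem (s := {n | ∃ ω : List (Letter Λ S), wordVal ω = r ∧ wordLen ω = n})
    ⟨_, ω₀, h₀, rfl⟩

theorem length_mul_le_add (r r' : R) :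
    length Λ S (r * r') ≤ length Λ S r + length Λ S r' := by
  obtain ⟨ω, hω, hl⟩ := h.exists_minimal_word r
  obtain ⟨ω', hω', hl'⟩ := h.exists_minimal_word r'
  rw [← hl, ← hl', ← wordLen_append, ← hω, ← hω', ← wordVal_append]
  exact length_wordVal_le _

include hcs

theorem length_mul_mul_le {e : R} (he : e ∈ Λ) (w₁ w₂ : Rˣ) :
    length Λ S (w₁ * e * w₂) ≤ cs.length w₁ + cs.length w₂ := by
  have h1 := h.length_mul_le_add (w₁ * e) w₂
  have h2 := h.length_mul_le_add w₁ e
  have h3 := length_unit_le (Λ := Λ) hcs w₁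
  have h4 := length_unit_le (Λ := Λ) hcs w₂
  rw [length_mem_le he] at h2
  omega

/-- To prepend `f ∈ Λ` to `w₁ e w₂`, write `w₁ = a x b` with `a ∈ W(f)`, `b ∈ W(e)` and `x` doubly
reduced. Then `f w₁ e w₂ = a (f x e) b w₂` with `f x e ∈ Λ`, so `x` disappears and the length does
not grow. -/
theorem exists_rep_of_word (ω : List (Letter Λ S)) :
    ∃ e ∈ Λ, ∃ w₁ w₂ : Rˣ, wordVal ω = w₁ * e * w₂ ∧
      cs.length w₁ + cs.length w₂ ≤ wordLen ω := by
  induction ω with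
  | nil => exact ⟨1, h.one_mem, 1, 1, by simp [wordVal], by simp⟩
  | cons x ω ih =>
    obtain ⟨e, he, w₁, w₂, hv, hl⟩ := ih
    rcases x with s | ⟨f, hf, -⟩
    · refine ⟨e, he, cs.simple s * w₁, w₂, ?_, ?_⟩
      · rw [wordVal_cons, hv, hcs]
        simp [Letter.val, mul_assoc]
      · have := cs.length_mul_le (cs.simple s) w₁
        rw [cs.length_simple] at this
        rw [wordLen_cons, Letter.len]
        omega
    · obtain ⟨a, ha, x, b, hb, hw, hxl, hxr, hlen⟩ :=
        cs.exists_double_reduced (commType cs f) (commType cs e) w₁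
      rw [← h.centralizer_eq hcs hf] at ha
      rw [← h.centralizer_eq hcs he] at hb
      obtain ⟨g, hg, hge, -, -, -⟩ := h.mul_mul_eq_of_reduced hcs he hf hxl hxr
      refine ⟨g, hg, a, b * w₂, ?_, ?_⟩
      · rw [wordVal_cons, hv, hw, mul_mul_unit_comm hb]
        have ha : (a : R) * f = f * a := ha
        simp only [Letter.val, Units.val_mul, ← hge, ← mul_assoc, ← ha]
      · have := cs.length_mul_le b w₂
        rw [wordLen_cons, Letter.len]
        omega

theorem exists_leftNormal (r : R) : ∃ e ∈ Λ, ∃ w₁ w₂ : Rˣ, r = w₁ * e * w₂ ∧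
    cs.IsRightReduced (fixType cs e) w₁ ∧ cs.IsLeftReduced (commType cs e) w₂ := by
  obtain ⟨ω, rfl⟩ := h.exists_word r
  obtain ⟨e, he, w₁, w₂, hv, -⟩ := h.exists_rep_of_word hcs ω
  obtain ⟨a, ha, y, rfl, hy⟩ := cs.exists_mul_isLeftReduced (commType cs e) w₂
  rw [← h.centralizer_eq hcs he] at ha
  rw [← mul_mul_unit_comm ha] at hv
  obtain ⟨z, d, hd, hz, hzr⟩ := cs.exists_isRightReduced_mul (fixType cs e) (w₁ * a)
  rw [← h.fixer_eq hcs he] at hd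
  rw [hz, mul_mul_unit_of_mem_fixer hd] at hv
  exact ⟨e, he, z, y, hv, hzr, hy⟩

theorem exists_rightNormal (r : R) : ∃ e ∈ Λ, ∃ w₁ w₂ : Rˣ, r = w₁ * e * w₂ ∧
    cs.IsRightReduced (commType cs e) w₁ ∧ cs.IsLeftReduced (fixType cs e) w₂ := by
  obtain ⟨ω, rfl⟩ := h.exists_word r
  obtain ⟨e, he, w₁, w₂, hv, -⟩ := h.exists_rep_of_word hcs ω
  obtain ⟨y, a, ha, rfl, hy⟩ := cs.exists_isRightReduced_mul (commType cs e) w₁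
  rw [← h.centralizer_eq hcs he] at ha
  rw [mul_mul_unit_comm ha] at hv
  obtain ⟨d, hd, z, hz, hzr⟩ := cs.exists_mul_isLeftReduced (fixType cs e) (a * w₂)
  rw [← h.fixer_eq hcs he] at hd
  rw [hz, mul_unit_mul_of_mem_fixer hd] at hv
  exact ⟨e, he, y, z, hv, hy, hzr⟩

/-- Any competitor has the form `v₁ = w₁ d c`, `v₂ = d⁻¹ k c⁻¹ w₂` with `c ∈ W^⋆(e)` and `d, k ∈
W_⋆(e)`. Reducedness of `w₂` puts all of `ℓ(c)` into `ℓ(v₂)`, which pays for the at most `ℓ(c)` lost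
in `v₁`; reducedness of `w₁` gives `ℓ(w₁ d) ≥ ℓ(w₁)`. -/
theorem length_of_leftNormal {e : R} (he : e ∈ Λ) {w₁ w₂ : Rˣ}
    (h₁ : cs.IsRightReduced (fixType cs e) w₁) (h₂ : cs.IsLeftReduced (commType cs e) w₂) :
    length Λ S (w₁ * e * w₂) = cs.length w₁ + cs.length w₂ := by
  apply le_antisymm (h.length_mul_mul_le hcs he w₁ w₂)
  obtain ⟨ω, hω, hl⟩ := h.exists_minimal_word (w₁ * e * w₂)
  obtain ⟨f, hf, v₁, v₂, hv, hle⟩ := h.exists_rep_of_word hcs ω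
  rw [← hl]
  refine le_trans ?_ hle
  rw [hω] at hv
  obtain ⟨rfl, ha, hab⟩ := h.eq_of_mul_mul_eq he hf hv
  obtain ⟨c, hc, d, hd, hcd⟩ := h.exists_eq_mul_of_mem_centralizer hcs he ha
  have hv₁ : v₁ = w₁ * d * c := by
    rw [mul_assoc, h.mul_comm_of_mem hcs he hd hc, ← hcd, mul_inv_cancel_left]
  have hb : c⁻¹ * (w₁⁻¹ * v₁ * (v₂ * w₂⁻¹)) * c ∈ fixer e := by
    have := conj_mem_fixer (Subgroup.inv_mem _ (h.parabolic_moveType_le hcs he hc)) hab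
    rwa [inv_inv] at this
  have hv₂ : v₂ = d⁻¹ * (c⁻¹ * (w₁⁻¹ * v₁ * (v₂ * w₂⁻¹)) * c) * c⁻¹ * w₂ := by
    rw [hcd]
    group
  generalize c⁻¹ * (w₁⁻¹ * v₁ * (v₂ * w₂⁻¹)) * c = k at hb hv₂
  have hdk : d⁻¹ * k ∈ fixer e := Subgroup.mul_mem _ (Subgroup.inv_mem _ hd) hb
  have hmem : d⁻¹ * k * c⁻¹ ∈ cs.parabolic (commType cs e) := by
    rw [← h.centralizer_eq hcs he]
    exact Subgroup.mul_mem _ (fixer_le_centralizer e hdk)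
      (Subgroup.inv_mem _ (h.parabolic_moveType_le hcs he hc))
  have l2 := h₂.length_mul hmem
  rw [← hv₂, h.mul_comm_of_mem hcs he hdk (Subgroup.inv_mem _ hc),
    h.length_mul_of_mem hcs he (Subgroup.inv_mem _ hc) hdk, cs.length_inv] at l2
  have l1 := cs.length_le_length_mul_add_right (w₁ * d) c
  rw [← hv₁] at l1
  rw [h.fixer_eq hcs he] at hd
  rw [h₁.length_mul hd] at l1
  omega

/-- Moving the `W(e)`-part of `w₂` across `e` gives a left normal form: that part lies in `W^⋆(e)`,
as its `W_⋆(e)`-factor is trivial by reducedness. -/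
theorem length_of_rightNormal {e : R} (he : e ∈ Λ) {w₁ w₂ : Rˣ}
    (h₁ : cs.IsRightReduced (commType cs e) w₁) (h₂ : cs.IsLeftReduced (fixType cs e) w₂) :
    length Λ S (w₁ * e * w₂) = cs.length w₁ + cs.length w₂ := by
  obtain ⟨a, ha, y, rfl, hy⟩ := cs.exists_mul_isLeftReduced (commType cs e) w₂
  have hlen := hy.length_mul ha
  have ha' := ha
  rw [← h.centralizer_eq hcs he] at ha'
  obtain ⟨c, hc, b, hb, rfl⟩ := h.exists_eq_mul_of_mem_centralizer hcs he ha'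
  have hy' := h.isLeftReduced_mul hcs he (hy.mono (fixType_subset cs e)) hc
  have hcb := h.mul_comm_of_mem hcs he hb hc
  have hb1 : b = 1 := by
    have hb' := hb
    rw [h.fixer_eq hcs he] at hb'
    rw [← hcb, mul_assoc] at h₂
    exact hy'.eq_one_of_mul hb' h₂
  subst hb1
  rw [mul_one] at *
  rw [← mul_mul_unit_comm ha', h.length_of_leftNormal hcs he
    (h.isRightReduced_mul hcs he (h₁.mono (fixType_subset cs e)) hc) hy, hlen, h₁.length_mul ha]
  omega

/-- By Deodhar's lemma, either `s w₁` is again reduced and the length formula applies, or `s w₁ = w₁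
s_j` with `s_j` absorbed by `e`. -/
theorem length_simple_mul_cases (i : S) (r : R) :
    length Λ S (cs.simple i * r) = length Λ S r + 1 ∨
      length Λ S (cs.simple i * r) + 1 = length Λ S r ∨ cs.simple i * r = r := by
  obtain ⟨e, he, w₁, w₂, rfl, h₁, h₂⟩ := h.exists_leftNormal hcs r
  rcases h₁.simple_mul i with h₃ | ⟨j, hj, h₃⟩
  · have := h.length_of_leftNormal hcs he h₃ h₂
    rw [Units.val_mul, mul_assoc, mul_assoc, ← mul_assoc (w₁ : R)] at this
    rw [this, h.length_of_leftNormal hcs he h₁ h₂]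
    rcases cs.length_simple_mul w₁ i with h4 | h4 <;> omega
  · right; right
    rw [← mul_assoc, ← mul_assoc, ← Units.val_mul, h₃, mul_mul_unit_of_mem_fixer hj]

omit h hcs in
/-- The three ways in which right multiplication by a simple reflection can act on a
left normal form. -/
theorem mul_simple_cases {e : R} {w₁ w₂ : Rˣ}
    (h₂ : cs.IsLeftReduced (commType cs e) w₂) (j : S) :
    cs.IsLeftReduced (commType cs e) (w₂ * cs.simple j) ∨
      (w₁ : R) * e * w₂ * cs.simple j = w₁ * e * w₂ ∨
      ∃ k ∈ moveType cs e, ∀ v : Rˣ,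
        (v : R) * e * w₂ * cs.simple j = ((v * cs.simple k : Rˣ) : R) * e * w₂ := by
  rcases h₂.mul_simple j with h₃ | ⟨k, hk, h₃⟩
  · exact Or.inl h₃
  · right
    have key : ∀ v : Rˣ, (v : R) * e * w₂ * cs.simple j =
        ((v * cs.simple k : Rˣ) : R) * e * w₂ := by
      intro v
      rw [mul_mul_unit_comm hk, ← h₃, Units.val_mul, mul_assoc _ (w₂ : R)]
    by_cases hf : k ∈ fixType cs e
    · left
      rw [key, mul_mul_unit_of_mem_fixer hf]
    · exact Or.inr ⟨k, ⟨hk, hf⟩, key⟩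

theorem length_mul_simple_cases (j : S) (r : R) :
    length Λ S (r * cs.simple j) = length Λ S r + 1 ∨
      length Λ S (r * cs.simple j) + 1 = length Λ S r ∨ r * cs.simple j = r := by
  obtain ⟨e, he, w₁, w₂, rfl, h₁, h₂⟩ := h.exists_leftNormal hcs r
  rw [h.length_of_leftNormal hcs he h₁ h₂]
  rcases mul_simple_cases (w₁ := w₁) h₂ j with h₃ | h₃ | ⟨k, hk, h₃⟩
  · have := h.length_of_leftNormal hcs he h₁ h₃
    rw [Units.val_mul, ← mul_assoc] at this
    rw [this]
    rcases cs.length_mul_simple w₂ j with h4 | h4 <;> omega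
  · exact Or.inr (Or.inr h₃)
  · rw [h₃, h.length_of_leftNormal hcs he (h.isRightReduced_mul hcs he h₁
      (CoxeterSystem.simple_mem_parabolic hk)) h₂]
    rcases cs.length_mul_simple w₁ k with h4 | h4 <;> omega

/-- The folding property for generalised Renner--Coxeter systems. -/
theorem simple_mul_eq_mul_simple (i j : S) (r : R)
    (hi : length Λ S (cs.simple i * r) = length Λ S r + 1)
    (hj : length Λ S (r * cs.simple j) = length Λ S r + 1)
    (hij : length Λ S (cs.simple i * r * cs.simple j) = length Λ S r) :
    cs.simple i * r = r * cs.simple j := by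
  obtain ⟨e, he, w₁, w₂, rfl, h₁, h₂⟩ := h.exists_leftNormal hcs r
  have hr := h.length_of_leftNormal hcs he h₁ h₂
  have hassoc : (cs.simple i : R) * (w₁ * e * w₂) = ((cs.simple i * w₁ : Rˣ) : R) * e * w₂ := by
    simp only [Units.val_mul, mul_assoc]
  rw [hassoc] at hi hij ⊢
  rcases h₁.simple_mul i with h₃ | ⟨k, hk, h₃⟩
  swap
  · rw [h₃, mul_mul_unit_of_mem_fixer hk] at hi
    omega
  have hsr := h.length_of_leftNormal hcs he h₃ h₂
  rcases mul_simple_cases (w₁ := w₁) h₂ j with h₄ | h₄ | ⟨k, hk, h₄⟩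
  · have e1 := h.length_of_leftNormal hcs he h₁ h₄
    have e2 := h.length_of_leftNormal hcs he h₃ h₄
    rw [Units.val_mul w₂, ← mul_assoc] at e1 e2
    omega
  · rw [h₄] at hj
    omega
  -- The only case compatible with the lengths: the right reflection crosses `e` and acts on `w₁`
  -- from the right, so folding in the Coxeter group applies to `w₁`.
  · have hk' := CoxeterSystem.simple_mem_parabolic (cs := cs) hk
    have e1 := h.length_of_leftNormal hcs he (h.isRightReduced_mul hcs he h₁ hk') h₂
    have e2 := h.length_of_leftNormal hcs he (h.isRightReduced_mul hcs he h₃ hk') h₂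
    rw [← h₄] at e1 e2
    rw [h₄, CoxeterSystem.simple_mul_eq_mul_simple (cs := cs)]
    · rw [cs.not_isLeftDescent_iff]; omega
    · rw [cs.not_isRightDescent_iff]; omega
    · omega

/-- The normal form of `r f` is `z g y`, where `w₁ = z k` with lengths adding and `k ∈ W_⋆(g)`. If
`s` shortens `r f`, it shortens `z`, hence `w₁` and `r`. -/
theorem length_mul_le_length_simple_mul_mul {f : R} (hf : f ∈ Λ) (i : S) (r : R)
    (hi : length Λ S r < length Λ S (cs.simple i * r)) :
    length Λ S (r * f) ≤ length Λ S (cs.simple i * (r * f)) := by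
  obtain ⟨e, he, w₁, w₂, rfl, h₁, h₂⟩ := h.exists_leftNormal hcs r
  obtain ⟨x, b, hb, rfl, hx⟩ := cs.exists_isRightReduced_mul (commType cs f) w₂
  have hlen := hx.length_mul hb
  obtain ⟨g, hg, hxg, hge, hgf, hxf⟩ := h.mul_mul_eq_of_reduced hcs hf he (h₂.of_mul hlen) hx
  rw [← h.centralizer_eq hcs hf] at hb
  obtain ⟨c, hc, y, rfl, hy⟩ := cs.exists_mul_isLeftReduced (commType cs g) b
  have hcy := hy.length_mul hc
  rw [← h.centralizer_eq hcs hg] at hc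
  obtain ⟨p, hp, d, hd, rfl⟩ := h.exists_eq_mul_of_mem_centralizer hcs hg hc
  have hpe : p ∈ cs.parabolic (commType cs e) := by
    rw [← h.centralizer_eq hcs he]
    exact h.parabolic_moveType_le hcs he
      (CoxeterSystem.parabolic_mono (h.moveType_mono hcs hg he hge) hp)
  -- Since `x` fixes `g`, it commutes with `p ∈ W^⋆(g)`, so `p ∈ W(e)` would split off on the left
  -- of `w₂`, which is reduced for `W(e)`. Thus nothing crosses `g` into the left factor.
  have hp1 : p = 1 := by
    have e1 := h₂.length_mul (Subgroup.inv_mem _ hpe)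
    rw [show p⁻¹ * (x * (p * d * y)) = x * (d * y) by
      rw [mul_assoc p, ← mul_assoc x p, h.mul_comm_of_mem hcs hg hxf hp, mul_assoc p,
        inv_mul_cancel_left], cs.length_inv, hlen, hcy, h.length_mul_of_mem hcs hg hp hd] at e1
    have e2 := cs.length_mul_le x (d * y)
    have e3 := cs.length_mul_le d y
    rw [← cs.length_eq_zero_iff]
    omega
  subst hp1
  rw [one_mul] at *
  obtain ⟨z, k, hk, rfl, hz⟩ := cs.exists_isRightReduced_mul (fixType cs g) w₁
  have hzk := hz.length_mul hk
  rw [← h.fixer_eq hcs hg] at hk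
  have hrf : ((z * k : Rˣ) : R) * e * ((x * (d * y) : Rˣ) : R) * f = z * g * y := by
    have hb : ((d * y : Rˣ) : R) * f = f * ((d * y : Rˣ) : R) := hb
    rw [Units.val_mul x, mul_assoc, mul_assoc (x : R), hb, ← mul_assoc, ← mul_assoc,
      mul_assoc _ e, mul_assoc _ _ f, hxg, mul_unit_mul_of_mem_fixer hd,
      mul_mul_unit_of_mem_fixer hk]
  have hassoc : (cs.simple i : R) * (z * g * y) = ((cs.simple i * z : Rˣ) : R) * g * y := by
    simp only [Units.val_mul, mul_assoc]
  rw [hrf]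
  rcases hz.simple_mul i with h₃ | ⟨l, hl, h₃⟩
  · rw [hassoc, h.length_of_leftNormal hcs hg h₃ hy, h.length_of_leftNormal hcs hg hz hy]
    by_contra hlt
    rw [h.length_of_leftNormal hcs he h₁ h₂,
      show (cs.simple i : R) * (((z * k : Rˣ) : R) * e * ((x * (d * y) : Rˣ) : R)) =
        ((cs.simple i * (z * k) : Rˣ) : R) * e * ((x * (d * y) : Rˣ) : R) by
          simp only [Units.val_mul, mul_assoc]] at hi
    have e1 := h.length_mul_mul_le hcs he (cs.simple i * (z * k)) (x * (d * y))
    have e2 := cs.length_mul_le (cs.simple i * z) k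
    rw [mul_assoc (cs.simple i)] at e2
    omega
  · rw [hassoc, h₃, mul_mul_unit_of_mem_fixer hl]

/-- The mirror argument, run on right normal forms so that the factor met by the reflection is
minimal modulo `W_⋆(e)`. -/
theorem length_mul_le_length_mul_mul_simple {f : R} (hf : f ∈ Λ) (i : S) (r : R)
    (hi : length Λ S r < length Λ S (r * cs.simple i)) :
    length Λ S (f * r) ≤ length Λ S (f * r * cs.simple i) := by
  obtain ⟨e, he, w₁, w₂, rfl, h₁, h₂⟩ := h.exists_rightNormal hcs r
  obtain ⟨b, hb, x, rfl, hx⟩ := cs.exists_mul_isLeftReduced (commType cs f) w₁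
  have hlen := hx.length_mul hb
  obtain ⟨g, hg, hxg, hgf, hge, hxf⟩ := h.mul_mul_eq_of_reduced hcs he hf hx (h₁.of_mul hlen)
  rw [← h.centralizer_eq hcs hf] at hb
  obtain ⟨y, c, hc, rfl, hy⟩ := cs.exists_isRightReduced_mul (commType cs g) b
  have hcy := hy.length_mul hc
  rw [← h.centralizer_eq hcs hg] at hc
  obtain ⟨p, hp, d, hd, rfl⟩ := h.exists_eq_mul_of_mem_centralizer hcs hg hc
  have hpe : p ∈ cs.parabolic (commType cs e) := by
    rw [← h.centralizer_eq hcs he]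
    exact h.parabolic_moveType_le hcs he
      (CoxeterSystem.parabolic_mono (h.moveType_mono hcs hg he hge) hp)
  have hp1 : p = 1 := by
    have e1 := h₁.length_mul (Subgroup.inv_mem _ hpe)
    rw [show y * (p * d) * x * p⁻¹ = y * d * x by
      rw [← h.mul_comm_of_mem hcs hg hd hp, mul_assoc y, mul_assoc d,
        ← h.mul_comm_of_mem hcs hg hxf hp]; group, cs.length_inv, hlen, hcy,
        h.length_mul_of_mem hcs hg hp hd] at e1
    have e2 := cs.length_mul_le (y * d) x
    have e3 := cs.length_mul_le y d
    rw [← cs.length_eq_zero_iff]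
    omega
  subst hp1
  rw [one_mul] at *
  obtain ⟨k, hk, z, rfl, hz⟩ := cs.exists_mul_isLeftReduced (fixType cs g) w₂
  have hzk := hz.length_mul hk
  rw [← h.fixer_eq hcs hg] at hk
  have hrf : f * (((y * d * x : Rˣ) : R) * e * ((k * z : Rˣ) : R)) = y * g * z := by
    have hb : ((y * d : Rˣ) : R) * f = f * ((y * d : Rˣ) : R) := hb
    rw [Units.val_mul _ x, ← mul_assoc, ← mul_assoc, ← mul_assoc, ← hb, mul_assoc _ f,
      mul_assoc _ _ e, hxg, mul_mul_unit_of_mem_fixer hd, mul_unit_mul_of_mem_fixer hk]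
  have hassoc : (y : R) * g * z * cs.simple i = y * g * ((z * cs.simple i : Rˣ) : R) := by
    simp only [Units.val_mul, mul_assoc]
  rw [hrf]
  rcases hz.mul_simple i with h₃ | ⟨l, hl, h₃⟩
  · rw [hassoc, h.length_of_rightNormal hcs hg hy h₃, h.length_of_rightNormal hcs hg hy hz]
    by_contra hlt
    rw [h.length_of_rightNormal hcs he h₁ h₂,
      show ((y * d * x : Rˣ) : R) * e * ((k * z : Rˣ) : R) * cs.simple i =
        ((y * d * x : Rˣ) : R) * e * ((k * z * cs.simple i : Rˣ) : R) by
          simp only [Units.val_mul, mul_assoc]] at hi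
    have e1 := h.length_mul_mul_le hcs he (y * d * x) (k * z * cs.simple i)
    have e2 := cs.length_mul_le k (z * cs.simple i)
    rw [← mul_assoc k] at e2
    omega
  · rw [hassoc, h₃, mul_unit_mul_of_mem_fixer hl]

omit hcs

theorem length_mul_left_cases {s : Rˣ} (hs : s ∈ S) (r : R) :
    length Λ S (s * r) = length Λ S r + 1 ∨ length Λ S (s * r) + 1 = length Λ S r ∨
      s * r = r := by
  obtain ⟨M, cs, hcs⟩ := h.coxeter
  simpa [hcs] using h.length_simple_mul_cases hcs ⟨s, hs⟩ r

theorem length_mul_right_cases {s : Rˣ} (hs : s ∈ S) (r : R) :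
    length Λ S (r * s) = length Λ S r + 1 ∨ length Λ S (r * s) + 1 = length Λ S r ∨
      r * s = r := by
  obtain ⟨M, cs, hcs⟩ := h.coxeter
  simpa [hcs] using h.length_mul_simple_cases hcs ⟨s, hs⟩ r

theorem mul_left_eq_mul_right {s t : Rˣ} (hs : s ∈ S) (ht : t ∈ S) {r : R}
    (h₁ : length Λ S (s * r) = length Λ S r + 1) (h₂ : length Λ S (r * t) = length Λ S r + 1)
    (h₃ : length Λ S (s * r * t) = length Λ S r) : s * r = r * t := by
  obtain ⟨M, cs, hcs⟩ := h.coxeter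
  have := h.simple_mul_eq_mul_simple hcs ⟨s, hs⟩ ⟨t, ht⟩ r
  simp only [hcs] at this
  exact this h₁ h₂ h₃

theorem length_mul_idem_le {s : Rˣ} (hs : s ∈ S) {f : R} (hf : f ∈ Λ) {r : R}
    (hr : length Λ S r < length Λ S (s * r)) :
    length Λ S (r * f) ≤ length Λ S (s * (r * f)) := by
  obtain ⟨M, cs, hcs⟩ := h.coxeter
  have := h.length_mul_le_length_simple_mul_mul hcs hf ⟨s, hs⟩ r
  simp only [hcs] at this
  exact this hr

theorem length_idem_mul_le {s : Rˣ} (hs : s ∈ S) {f : R} (hf : f ∈ Λ) {r : R}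
    (hr : length Λ S r < length Λ S (r * s)) :
    length Λ S (f * r) ≤ length Λ S (f * r * s) := by
  obtain ⟨M, cs, hcs⟩ := h.coxeter
  have := h.length_mul_le_length_mul_mul_simple hcs hf ⟨s, hs⟩ r
  simp only [hcs] at this
  exact this hr

theorem sq_eq_one {s : Rˣ} (hs : s ∈ S) : s * s = 1 := by
  obtain ⟨M, cs, hcs⟩ := h.coxeter
  simpa [hcs] using cs.simple_mul_simple_self ⟨s, hs⟩

theorem length_generator {s : Rˣ} (hs : s ∈ S) : length Λ S (s : R) = 1 := by
  obtain ⟨M, cs, hcs⟩ := h.coxeter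
  have h1 := h.length_mul_left_cases hs 1
  rw [mul_one, length_one_eq] at h1
  rcases h1 with h1 | h1 | h1
  · exact h1
  · omega
  · have h2 := cs.length_simple ⟨s, hs⟩
    rw [(hcs ⟨s, hs⟩).trans (Units.val_eq_one.1 h1), cs.length_one] at h2
    omega

end IsSystem

end Length

end RennerCoxeter

/-! ### The left and right operators and their commutation. -/

namespace RennerCoxeter

open MulOpposite

section FreeModule

variable {R : Type*} {A : Type*} [Ring A]

theorem linearCombination_T (f : R → (R →₀ A)) (r : R) :
    Finsupp.linearCombination A f (T A r) = f r := by
  simp [T]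

theorem smul_T (a : A) (r : R) : a • T A r = Finsupp.single r a := by simp [T]

theorem op_smul_T (a : A) (r : R) : op a • T A r = a • T A r := by simp [T]

theorem linearMap_ext_T {V : Type*} [AddCommGroup V] [Module A V] {f g : (R →₀ A) →ₗ[A] V}
    (hfg : ∀ r, f (T A r) = g (T A r)) : f = g := by
  refine Finsupp.lhom_ext fun r a => ?_
  rw [← smul_T, map_smul, map_smul, hfg]

theorem induction_T {p : (R →₀ A) → Prop} (x : R →₀ A) (zero : p 0)
    (add : ∀ x y, p x → p y → p (x + y)) (smul : ∀ (a : A) (r : R), p (a • T A r)) : p x := by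
  induction x using Finsupp.induction_linear with
  | zero => exact zero
  | add x y hx hy => exact add x y hx hy
  | single r a => rw [← smul_T]; exact smul a r

theorem linearCombination_op_smul {f : R → (R →₀ A)} (hf : ∀ r (a : A), op a • f r = a • f r)
    (a : A) (x : R →₀ A) :
    Finsupp.linearCombination A f (op a • x) = op a • Finsupp.linearCombination A f x := by
  induction x using induction_T with
  | zero => simp
  | add x y hx hy => rw [smul_add, map_add, map_add, smul_add, hx, hy]
  | smul b r => rw [smul_comm (op a) b, map_smul, op_smul_T, map_smul, linearCombination_T,
      map_smul, linearCombination_T, smul_comm (op a) b, hf]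

theorem op_smul_smul_T {b : A} (hb : b ∈ Subring.center A) (a : A) (r : R) :
    op a • b • T A r = a • b • T A r := by
  rw [smul_comm, op_smul_T, smul_smul, smul_smul, Subring.mem_center_iff.1 hb]

end FreeModule

section Operators

variable {R : Type*} [Monoid R] (Λ : Set R) (S : Set Rˣ) {A : Type*} [Ring A] (q : A)

open Classical in
/-- The prescribed value of `T_x T_r`. -/
noncomputable def leftVal : Letter Λ S → R → (R →₀ A)
  | Sum.inl s, r =>
    if length Λ S ((s : Rˣ) * r) = length Λ S r + 1 then T A (((s : Rˣ) : R) * r)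
    -- Testing `s r = r` replaces testing equality of lengths; in a system the two agree by
    -- `length_mul_left_cases`.
    else if ((s : Rˣ) : R) * r = r then q • T A r
    else (q - 1) • T A r + q • T A (((s : Rˣ) : R) * r)
  | Sum.inr e, r => q ^ (length Λ S r - length Λ S (e * r)) • T A ((e : R) * r)

open Classical in
/-- The value of `T_r T_x`. -/
noncomputable def rightVal : Letter Λ S → R → (R →₀ A)
  | Sum.inl s, r =>
    if length Λ S (r * (s : Rˣ)) = length Λ S r + 1 then T A (r * ((s : Rˣ) : R))
    else if r * ((s : Rˣ) : R) = r then q • T A r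
    else (q - 1) • T A r + q • T A (r * ((s : Rˣ) : R))
  | Sum.inr e, r => q ^ (length Λ S r - length Λ S (r * e)) • T A (r * (e : R))

/-- Left multiplication by `T_x`. -/
noncomputable def leftOp (x : Letter Λ S) : Module.End A (R →₀ A) :=
  Finsupp.linearCombination A (leftVal Λ S q x)

/-- Right multiplication by `T_x`. -/
noncomputable def rightOp (x : Letter Λ S) : Module.End A (R →₀ A) :=
  Finsupp.linearCombination A (rightVal Λ S q x)

variable {Λ S}

variable {q}

/-- Centrality of `q` enters here: it makes the left operators linear for the right action of `A`.
-/
theorem op_smul_leftVal (hq : q ∈ Subring.center A) (x : Letter Λ S) (r : R) (a : A) :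
    op a • leftVal Λ S q x r = a • leftVal Λ S q x r := by
  rcases x with s | e
  · simp only [leftVal]
    split_ifs
    · exact op_smul_T a _
    · exact op_smul_smul_T hq a _
    · rw [smul_add, smul_add, op_smul_smul_T hq, op_smul_smul_T (sub_mem hq (one_mem _))]
  · exact op_smul_smul_T (pow_mem hq _) a _

theorem leftOp_op_smul (hq : q ∈ Subring.center A) (x : Letter Λ S) (a : A) (v : R →₀ A) :
    leftOp Λ S q x (op a • v) = op a • leftOp Λ S q x v :=
  linearCombination_op_smul (op_smul_leftVal hq x) a v

theorem leftOp_T (x : Letter Λ S) (r : R) : leftOp Λ S q x (T A r) = leftVal Λ S q x r :=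
  linearCombination_T _ r

theorem rightOp_T (x : Letter Λ S) (r : R) : rightOp Λ S q x (T A r) = rightVal Λ S q x r :=
  linearCombination_T _ r

variable {s t : Rˣ} {hs : s ∈ S} {r : R}

theorem leftOp_of_gt (hr : length Λ S (s * r) = length Λ S r + 1) :
    leftOp Λ S q (Sum.inl ⟨s, hs⟩) (T A r) = T A ((s : R) * r) := by
  rw [leftOp_T, leftVal, if_pos hr]

theorem leftOp_of_eq (hr : (s : R) * r = r) :
    leftOp Λ S q (Sum.inl ⟨s, hs⟩) (T A r) = q • T A r := by
  rw [leftOp_T, leftVal, if_neg (by rw [hr]; omega), if_pos hr]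

theorem leftOp_of_lt (hr : length Λ S (s * r) + 1 = length Λ S r) :
    leftOp Λ S q (Sum.inl ⟨s, hs⟩) (T A r) = (q - 1) • T A r + q • T A ((s : R) * r) := by
  have h1 : length Λ S (s * r) ≠ length Λ S r + 1 := by omega
  have h2 : (s : R) * r ≠ r := fun he => by rw [he] at hr; omega
  rw [leftOp_T, leftVal, if_neg h1, if_neg h2]

theorem leftOp_idem (e : (Λ \ {1} : Set R)) (r : R) : leftOp Λ S q (Sum.inr e) (T A r) =
    q ^ (length Λ S r - length Λ S (e * r)) • T A ((e : R) * r) :=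
  leftOp_T _ _

theorem rightOp_of_gt (hr : length Λ S (r * s) = length Λ S r + 1) :
    rightOp Λ S q (Sum.inl ⟨s, hs⟩) (T A r) = T A (r * (s : R)) := by
  rw [rightOp_T, rightVal, if_pos hr]

theorem rightOp_of_eq (hr : r * (s : R) = r) :
    rightOp Λ S q (Sum.inl ⟨s, hs⟩) (T A r) = q • T A r := by
  rw [rightOp_T, rightVal, if_neg (by rw [hr]; omega), if_pos hr]

theorem rightOp_of_lt (hr : length Λ S (r * s) + 1 = length Λ S r) :
    rightOp Λ S q (Sum.inl ⟨s, hs⟩) (T A r) = (q - 1) • T A r + q • T A (r * (s : R)) := by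
  have h1 : length Λ S (r * s) ≠ length Λ S r + 1 := by omega
  have h2 : r * (s : R) ≠ r := fun he => by rw [he] at hr; omega
  rw [rightOp_T, rightVal, if_neg h1, if_neg h2]

theorem rightOp_idem (e : (Λ \ {1} : Set R)) (r : R) : rightOp Λ S q (Sum.inr e) (T A r) =
    q ^ (length Λ S r - length Λ S (r * e)) • T A (r * (e : R)) :=
  rightOp_T _ _

namespace IsSystem

variable (h : IsSystem Λ S)

include h

theorem mul_mul_cancel_left {s : Rˣ} (hs : s ∈ S) (r : R) : (s : R) * (s * r) = r := by
  rw [← mul_assoc, ← Units.val_mul, h.sq_eq_one hs, Units.val_one, one_mul]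

theorem mul_mul_cancel_right {s : Rˣ} (hs : s ∈ S) (r : R) : r * (s : R) * s = r := by
  rw [mul_assoc, ← Units.val_mul, h.sq_eq_one hs, Units.val_one, mul_one]

theorem length_mul_idem_le_self {e : R} (he : e ∈ Λ) (r : R) :
    length Λ S (r * e) ≤ length Λ S r := by
  have := h.length_mul_le_add r e
  rwa [length_mem_le he, add_zero] at this

theorem length_idem_mul_le_self {e : R} (he : e ∈ Λ) (r : R) :
    length Λ S (e * r) ≤ length Λ S r := by
  have := h.length_mul_le_add e r
  rwa [length_mem_le he, zero_add] at this

theorem leftOp_rightOp_idem_idem (e f : (Λ \ {1} : Set R)) (r : R) :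
    leftOp Λ S q (Sum.inr e) (rightOp Λ S q (Sum.inr f) (T A r)) =
      rightOp Λ S q (Sum.inr f) (leftOp Λ S q (Sum.inr e) (T A r)) := by
  rw [leftOp_idem, rightOp_idem, map_smul, map_smul, leftOp_idem, rightOp_idem, smul_smul,
    smul_smul, ← pow_add, ← pow_add, mul_assoc]
  have h1 := h.length_mul_idem_le_self f.2.1 r
  have h2 := h.length_idem_mul_le_self e.2.1 r
  have h3 := h.length_mul_idem_le_self f.2.1 (e * r)
  have h4 := h.length_idem_mul_le_self e.2.1 (r * f)
  rw [mul_assoc] at h3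
  congr 2
  omega

/-- `length_mul_idem_le`, applied to `r` or to `s r`, rules out that `s` moves the lengths of `r`
and `r f` in opposite directions. In the remaining cases the powers of `q` match. -/
theorem leftOp_rightOp_simple_idem {s : Rˣ} (hs : s ∈ S) (f : (Λ \ {1} : Set R)) (r : R) :
    leftOp Λ S q (Sum.inl ⟨s, hs⟩) (rightOp Λ S q (Sum.inr f) (T A r)) =
      rightOp Λ S q (Sum.inr f) (leftOp Λ S q (Sum.inl ⟨s, hs⟩) (T A r)) := by
  have hf := f.2.1
  have l1 := h.length_mul_idem_le_self hf r
  have l2 := h.length_mul_idem_le_self hf (s * r)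
  rw [mul_assoc] at l2
  rw [rightOp_idem, map_smul]
  rcases h.length_mul_left_cases hs r with h1 | h1 | h1
  · have h2 := h.length_mul_idem_le hs hf (r := r) (by omega)
    rw [leftOp_of_gt h1, rightOp_idem, mul_assoc, h1]
    rcases h.length_mul_left_cases hs (r * f) with h3 | h3 | h3
    · rw [leftOp_of_gt h3, h3, Nat.add_sub_add_right]
    · omega
    · rw [leftOp_of_eq h3, h3, smul_smul, ← pow_succ, Nat.sub_add_comm l1]
  · have h2 := h.length_mul_idem_le hs hf (r := s * r) (by
      rw [h.mul_mul_cancel_left hs]; omega)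
    rw [mul_assoc, h.mul_mul_cancel_left hs] at h2
    rw [leftOp_of_lt h1, map_add, map_smul, map_smul, rightOp_idem, rightOp_idem, mul_assoc]
    rcases h.length_mul_left_cases hs (r * f) with h3 | h3 | h3
    · omega
    · rw [leftOp_of_lt h3, smul_add, smul_smul, smul_smul, smul_smul, smul_smul,
        show length Λ S (s * r) - length Λ S (s * (r * f)) =
          length Λ S r - length Λ S (r * f) by omega]
      congr 2
      · exact ((Commute.refl q).sub_left (Commute.one_left q)).pow_right _ |>.symm
      · exact ((Commute.refl q).pow_left _)
    -- With `N = ℓ(r) - ℓ(r f)`, the identity is `q^(N+1) = (q - 1) q^N + q q^(N-1)`; here `N ≥ 1`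
    -- because `s r f = r f` is no longer than `s r`.
    · rw [leftOp_of_eq h3, h3, smul_smul, smul_smul, smul_smul, ← add_smul,
        ← pow_succ', sub_mul, one_mul, ← pow_succ', ← pow_succ]
      rw [h3] at l2
      rw [show length Λ S (s * r) - length Λ S (r * f) + 1 =
        length Λ S r - length Λ S (r * f) by omega, sub_add_cancel]
  · have h2 : (s : R) * (r * f) = r * f := by rw [← mul_assoc, h1]
    rw [leftOp_of_eq h1, leftOp_of_eq h2, map_smul, rightOp_idem, smul_smul, smul_smul, ← pow_succ,
      ← pow_succ']

theorem leftOp_rightOp_idem_simple {t : Rˣ} (ht : t ∈ S) (f : (Λ \ {1} : Set R)) (r : R) :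
    leftOp Λ S q (Sum.inr f) (rightOp Λ S q (Sum.inl ⟨t, ht⟩) (T A r)) =
      rightOp Λ S q (Sum.inl ⟨t, ht⟩) (leftOp Λ S q (Sum.inr f) (T A r)) := by
  have hf := f.2.1
  have l1 := h.length_idem_mul_le_self hf r
  have l2 := h.length_idem_mul_le_self hf (r * t)
  rw [← mul_assoc] at l2
  rw [leftOp_idem, map_smul]
  rcases h.length_mul_right_cases ht r with h1 | h1 | h1
  · have h2 := h.length_idem_mul_le ht hf (r := r) (by omega)
    rw [rightOp_of_gt h1, leftOp_idem, ← mul_assoc, h1]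
    rcases h.length_mul_right_cases ht (f * r) with h3 | h3 | h3
    · rw [rightOp_of_gt h3, h3, Nat.add_sub_add_right]
    · omega
    · rw [rightOp_of_eq h3, h3, smul_smul, ← pow_succ, Nat.sub_add_comm l1]
  · have h2 := h.length_idem_mul_le ht hf (r := r * t) (by
      rw [h.mul_mul_cancel_right ht]; omega)
    rw [← mul_assoc, h.mul_mul_cancel_right ht] at h2
    rw [rightOp_of_lt h1, map_add, map_smul, map_smul, leftOp_idem, leftOp_idem, ← mul_assoc]
    rcases h.length_mul_right_cases ht (f * r) with h3 | h3 | h3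
    · omega
    · rw [rightOp_of_lt h3, smul_add, smul_smul, smul_smul, smul_smul, smul_smul,
        show length Λ S (r * t) - length Λ S (f * r * t) =
          length Λ S r - length Λ S (f * r) by omega]
      congr 2
      · exact ((Commute.refl q).sub_left (Commute.one_left q)).pow_right _
      · exact ((Commute.refl q).pow_left _).symm
    · rw [rightOp_of_eq h3, h3, smul_smul, smul_smul, smul_smul, ← add_smul,
        ← pow_succ', sub_mul, one_mul, ← pow_succ', ← pow_succ]
      rw [h3] at l2
      rw [show length Λ S (r * t) - length Λ S (f * r) + 1 =
        length Λ S r - length Λ S (f * r) by omega, sub_add_cancel]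
  · have h2 : (f : R) * r * t = f * r := by rw [mul_assoc, h1]
    rw [rightOp_of_eq h1, rightOp_of_eq h2, map_smul, leftOp_idem, smul_smul, smul_smul, ← pow_succ,
      ← pow_succ']

/-- The two sides could differ only when `s r` and `r t` have equal length and `s r t` has the
length of `r`; folding, applied to `r` or to `r t`, then gives `s r = r t`. -/
theorem leftOp_rightOp_simple_simple {s t : Rˣ} (hs : s ∈ S) (ht : t ∈ S) (r : R) :
    leftOp Λ S q (Sum.inl ⟨s, hs⟩) (rightOp Λ S q (Sum.inl ⟨t, ht⟩) (T A r)) =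
      rightOp Λ S q (Sum.inl ⟨t, ht⟩) (leftOp Λ S q (Sum.inl ⟨s, hs⟩) (T A r)) := by
  have hsr := h.length_mul_left_cases hs (r * t)
  have hrt := h.length_mul_right_cases ht (s * r)
  have hassoc : (s : R) * (r * t) = s * r * t := (mul_assoc _ _ _).symm
  rcases h.length_mul_left_cases hs r with h1 | h1 | h1
  · rcases h.length_mul_right_cases ht r with h2 | h2 | h2
    · rw [leftOp_of_gt h1, rightOp_of_gt h2]
      rcases hsr with h3 | h3 | h3
      · rw [leftOp_of_gt h3, rightOp_of_gt (by rw [← hassoc]; omega), hassoc]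
      · have h4 := h.mul_left_eq_mul_right hs ht h1 h2 (by rw [← hassoc]; omega)
        rw [leftOp_of_lt h3, rightOp_of_lt (by rw [← hassoc]; omega), hassoc, h4]
      -- If `s` fixed `r t`, lengths would force `t` to fix `s r`; then `s r = r t`, and cancelling
      -- `t` gives `s r = r`, contradicting the ascent.
      · have h4 := congrArg (length Λ S) h3
        rw [hassoc] at h3 h4
        have h5 : (s : R) * r * t = s * r := by
          rcases hrt with h5 | h5 | h5
          · omega
          · omega
          · exact h5
        have h6 : (s : R) * r = r := by
          rw [← h5, ← h3.symm.trans h5, h.mul_mul_cancel_right ht]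
        rw [h6] at h1
        omega
    -- `ℓ(s r t)` is within one of both `ℓ(r) - 1` and `ℓ(r) + 1`, so it equals `ℓ(r)`.
    · have h3 : length Λ S (s * r * t) + 1 = length Λ S (s * r) := by
        have hsr' := hsr.imp_right (Or.imp_right (congrArg (length Λ S)))
        have hrt' := hrt.imp_right (Or.imp_right (congrArg (length Λ S)))
        rw [hassoc] at hsr'
        omega
      rw [leftOp_of_gt h1, rightOp_of_lt h2, rightOp_of_lt h3, map_add, map_smul, map_smul,
        leftOp_of_gt h1, leftOp_of_gt (by rw [hassoc]; omega), hassoc]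
    · have h3 : (s : R) * r * t = s * r := by rw [← hassoc, h2]
      rw [leftOp_of_gt h1, rightOp_of_eq h2, rightOp_of_eq h3, map_smul, leftOp_of_gt h1]
  · rcases h.length_mul_right_cases ht r with h2 | h2 | h2
    · have h3 : length Λ S (s * r * t) = length Λ S (s * r) + 1 := by
        have hsr' := hsr.imp_right (Or.imp_right (congrArg (length Λ S)))
        have hrt' := hrt.imp_right (Or.imp_right (congrArg (length Λ S)))
        rw [hassoc] at hsr'
        omega
      rw [leftOp_of_lt h1, rightOp_of_gt h2, map_add, map_smul, map_smul, rightOp_of_gt h2,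
        rightOp_of_gt h3, leftOp_of_lt (by rw [hassoc]; omega), hassoc]
    · rw [leftOp_of_lt h1, rightOp_of_lt h2, map_add, map_smul, map_smul, map_add, map_smul,
        map_smul, leftOp_of_lt h1, rightOp_of_lt h2]
      rcases hsr with h3 | h3 | h3
      · have h4 := h.mul_left_eq_mul_right hs ht h3 (by rw [h.mul_mul_cancel_right ht]; omega)
          (by rw [mul_assoc, h.mul_mul_cancel_right ht]; omega)
        rw [h.mul_mul_cancel_right ht] at h4
        have h5 : r * t = s * r := by
          conv_rhs => rw [← h4]
          rw [h.mul_mul_cancel_left hs]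
        rw [leftOp_of_gt h3, rightOp_of_gt (by rw [← hassoc]; omega), hassoc, h5]
      · rw [leftOp_of_lt h3, rightOp_of_lt (by rw [← hassoc]; omega), hassoc]
        simp only [smul_add, sub_smul, one_smul, smul_sub]
        abel
      · have h4 := congrArg (length Λ S) h3
        rw [hassoc] at h3 h4
        have h5 : (s : R) * r * t = s * r := by
          rcases hrt with h5 | h5 | h5
          · omega
          · omega
          · exact h5
        have h6 : (s : R) * r = r := by
          rw [← h5, ← h3.symm.trans h5, h.mul_mul_cancel_right ht]
        rw [h6] at h1
        omega
    · have h3 : (s : R) * r * t = s * r := by rw [← hassoc, h2]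
      rw [leftOp_of_lt h1, rightOp_of_eq h2, map_add, map_smul, map_smul, map_smul,
        rightOp_of_eq h2, rightOp_of_eq h3, leftOp_of_lt h1]
      simp only [smul_add, sub_smul, one_smul, smul_sub]
  · have h2 : (s : R) * (r * t) = r * t := by rw [hassoc, h1]
    rw [leftOp_of_eq h1, map_smul]
    rcases h.length_mul_right_cases ht r with h3 | h3 | h3
    · rw [rightOp_of_gt h3, leftOp_of_eq h2]
    · rw [rightOp_of_lt h3, map_add, map_smul, map_smul, leftOp_of_eq h1, leftOp_of_eq h2]
      simp only [smul_add, sub_smul, one_smul, smul_sub]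
    · rw [rightOp_of_eq h3, map_smul, leftOp_of_eq h1]

variable (q)

theorem commute_leftOp_rightOp (x y : Letter Λ S) :
    Commute (leftOp Λ S q x) (rightOp Λ S q y) := by
  refine linearMap_ext_T fun r => ?_
  rcases x with ⟨s, hs⟩ | e <;> rcases y with ⟨t, ht⟩ | f
  · exact h.leftOp_rightOp_simple_simple hs ht r
  · exact h.leftOp_rightOp_simple_idem hs f r
  · exact h.leftOp_rightOp_idem_simple ht e r
  · exact h.leftOp_rightOp_idem_idem e f r

end IsSystem

end Operators

end RennerCoxeter

/-! ### Construction and uniqueness of the product. -/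

namespace RennerCoxeter

open MulOpposite

section Product

variable {R : Type*} [Monoid R] {Λ : Set R} {S : Set Rˣ} {A : Type*} [Ring A] (q : A)

/-- The composite of the operators `leftOp` along a word. -/
noncomputable def leftProd (ω : List (Letter Λ S)) : Module.End A (R →₀ A) :=
  (ω.map (leftOp Λ S q)).prod

/-- The composite of the operators `rightOp` along a reversed word. -/
noncomputable def rightProd (ω : List (Letter Λ S)) : Module.End A (R →₀ A) :=
  (ω.reverse.map (rightOp Λ S q)).prod

variable {q} in
theorem leftProd_op_smul (hq : q ∈ Subring.center A) (ω : List (Letter Λ S)) (a : A)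
    (v : R →₀ A) : leftProd q ω (op a • v) = op a • leftProd q ω v := by
  induction ω with
  | nil => rfl
  | cons x ω ih =>
    change leftOp Λ S q x (leftProd q ω (op a • v)) = op a • leftOp Λ S q x (leftProd q ω v)
    rw [ih, leftOp_op_smul hq]

namespace IsSystem

variable (h : IsSystem Λ S)

include h

theorem commute_leftProd_rightProd (ω ω' : List (Letter Λ S)) :
    Commute (leftProd q ω) (rightProd q ω') := by
  refine Commute.list_prod_left _ _ fun f hf => Commute.list_prod_right _ _ fun g hg => ?_
  obtain ⟨x, -, rfl⟩ := List.mem_map.1 hf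
  obtain ⟨y, -, rfl⟩ := List.mem_map.1 hg
  exact h.commute_leftOp_rightOp q x y

/-- Suffixes of a minimal word are minimal, so each letter of `S` raises the length by one and each
idempotent preserves it: only coefficients `1` occur. -/
theorem leftProd_T_one {ω : List (Letter Λ S)} (hω : wordLen ω = length Λ S (wordVal ω)) :
    leftProd q ω (T A 1) = T A (wordVal ω) := by
  induction ω with
  | nil => simp [leftProd, wordVal]
  | cons x ω ih =>
    have hle := length_wordVal_le ω
    change leftOp Λ S q x (leftProd q ω (T A 1)) = _
    rw [wordVal_cons] at hω ⊢
    rw [wordLen_cons] at hω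
    rcases x with ⟨s, hs⟩ | e
    · change 1 + wordLen ω = length Λ S (s * wordVal ω) at hω
      have h1 := h.length_mul_le_add s (wordVal ω)
      rw [h.length_generator hs] at h1
      rw [ih (by omega), leftOp_of_gt (by omega)]
      rfl
    · change 0 + wordLen ω = length Λ S (e * wordVal ω) at hω
      have h1 := h.length_idem_mul_le_self e.2.1 (wordVal ω)
      rw [ih (by omega), leftOp_idem, show length Λ S (wordVal ω) -
        length Λ S (e * wordVal ω) = 0 by omega, pow_zero, one_smul]
      rfl

theorem rightProd_T_one {ω : List (Letter Λ S)} (hω : wordLen ω = length Λ S (wordVal ω)) :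
    rightProd q ω (T A 1) = T A (wordVal ω) := by
  induction ω using List.reverseRecOn with
  | nil => simp [rightProd, wordVal]
  | append_singleton ω x ih =>
    have hle := length_wordVal_le ω
    have hx : wordVal [x] = x.val := by simp [wordVal]
    have hx' : wordLen [x] = x.len := by simp [wordLen]
    have hcomp : rightProd q (ω ++ [x]) (T A 1) =
        rightOp Λ S q x (rightProd q ω (T A 1)) := by simp [rightProd]
    rw [wordVal_append, hx] at hω ⊢
    rw [wordLen_append, hx'] at hω
    rw [hcomp]
    rcases x with ⟨s, hs⟩ | e
    · change wordLen ω + 1 = length Λ S (wordVal ω * s) at hω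
      have h1 := h.length_mul_le_add (wordVal ω) s
      rw [h.length_generator hs] at h1
      rw [ih (by omega), rightOp_of_gt (by omega)]
      rfl
    · change wordLen ω + 0 = length Λ S (wordVal ω * e) at hω
      have h1 := h.length_mul_idem_le_self e.2.1 (wordVal ω)
      rw [ih (by omega), rightOp_idem, show length Λ S (wordVal ω) -
        length Λ S (wordVal ω * e) = 0 by omega, pow_zero, one_smul]
      rfl

/-- A word of minimal length representing `r`. -/
noncomputable def minWord (r : R) : List (Letter Λ S) := (h.exists_minimal_word r).choose

theorem wordVal_minWord (r : R) : wordVal (h.minWord r) = r :=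
  (h.exists_minimal_word r).choose_spec.1

theorem wordLen_minWord (r : R) : wordLen (h.minWord r) = length Λ S r :=
  (h.exists_minimal_word r).choose_spec.2

theorem leftProd_minWord (r : R) : leftProd q (h.minWord r) (T A 1) = T A r := by
  rw [h.leftProd_T_one q (by rw [h.wordLen_minWord, h.wordVal_minWord]), h.wordVal_minWord]

theorem rightProd_minWord (r : R) : rightProd q (h.minWord r) (T A 1) = T A r := by
  rw [h.rightProd_T_one q (by rw [h.wordLen_minWord, h.wordVal_minWord]), h.wordVal_minWord]

/-- The product of the generic Hecke algebra. -/
noncomputable def heckeMul : (R →₀ A) →+ (R →₀ A) →+ (R →₀ A) :=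
  AddMonoidHom.flip
    { toFun := fun y =>
        (Finsupp.linearCombination A fun r => leftProd q (h.minWord r) y).toAddMonoidHom
      map_zero' := by
        ext1 r
        ext1 a
        simp
      map_add' := fun y z => by
        ext1 r
        ext1 a
        simp }

theorem heckeMul_eq (x y : R →₀ A) : h.heckeMul q x y =
    Finsupp.linearCombination A (fun r => leftProd q (h.minWord r) y) x := rfl

theorem heckeMul_smul_T (a : A) (r : R) (y : R →₀ A) :
    h.heckeMul q (a • T A r) y = a • leftProd q (h.minWord r) y := by
  rw [heckeMul_eq, map_smul, linearCombination_T]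

theorem heckeMul_T (r : R) (y : R →₀ A) :
    h.heckeMul q (T A r) y = leftProd q (h.minWord r) y := by
  rw [heckeMul_eq, linearCombination_T]

theorem heckeMul_rightProd (ω : List (Letter Λ S)) (x y : R →₀ A) :
    h.heckeMul q x (rightProd q ω y) = rightProd q ω (h.heckeMul q x y) := by
  induction x using induction_T with
  | zero => simp
  | add x x' hx hx' => rw [map_add, AddMonoidHom.add_apply, hx, hx', AddMonoidHom.add_apply,
      map_add]
  | smul a r =>
    rw [heckeMul_smul_T, heckeMul_smul_T, map_smul]
    exact congrArg _ (LinearMap.congr_fun (h.commute_leftProd_rightProd q (h.minWord r) ω) y)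

theorem heckeMul_T_one (x : R →₀ A) : h.heckeMul q x (T A 1) = x := by
  induction x using induction_T with
  | zero => simp
  | add x x' hx hx' => rw [map_add, AddMonoidHom.add_apply, hx, hx']
  | smul a r => rw [heckeMul_smul_T, leftProd_minWord]

/-- Left multiplications commute with the right operators, so `x T_r = x R(T_1) = R(x T_1) = R(x)`.
-/
theorem heckeMul_T_right (x : R →₀ A) (r : R) :
    h.heckeMul q x (T A r) = rightProd q (h.minWord r) x := by
  rw [← h.rightProd_minWord q r, heckeMul_rightProd, heckeMul_T_one]

theorem heckeMul_smul_middle (a : A) (x y : R →₀ A) :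
    h.heckeMul q (op a • x) y = h.heckeMul q x (a • y) := by
  induction x using induction_T with
  | zero => simp
  | add x x' hx hx' => rw [smul_add, map_add, AddMonoidHom.add_apply, hx, hx', map_add,
      AddMonoidHom.add_apply]
  | smul b r => rw [smul_comm, op_smul_T, smul_smul, heckeMul_smul_T, heckeMul_smul_T, map_smul,
      smul_smul]

variable {q}

theorem heckeMul_op_smul (hq : q ∈ Subring.center A) (a : A) (x y : R →₀ A) :
    h.heckeMul q x (op a • y) = op a • h.heckeMul q x y := by
  induction x using induction_T with
  | zero => simp
  | add x x' hx hx' => rw [map_add, AddMonoidHom.add_apply, hx, hx', AddMonoidHom.add_apply,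
      smul_add]
  | smul b r => rw [heckeMul_smul_T, heckeMul_smul_T, leftProd_op_smul hq, smul_comm]

theorem heckeMul_assoc (hq : q ∈ Subring.center A) (x y z : R →₀ A) :
    h.heckeMul q (h.heckeMul q x y) z = h.heckeMul q x (h.heckeMul q y z) := by
  induction z using induction_T with
  | zero => simp
  | add z z' hz hz' => simp only [map_add, hz, hz']
  -- The scalar `c` is first moved to the right action on the preceding factor, leaving a bare `T_r`
  -- whose right multiplication is known.
  | smul c r => rw [← heckeMul_smul_middle, ← heckeMul_smul_middle, heckeMul_T_right,
      heckeMul_T_right, heckeMul_rightProd, heckeMul_op_smul h hq]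

theorem isAlgebraMul_heckeMul (hq : q ∈ Subring.center A) :
    IsAlgebraMul (T A (1 : R)) (h.heckeMul q) where
  one_mul x := by
    induction x using induction_T with
    | zero => simp
    | add x x' hx hx' => rw [map_add, hx, hx']
    | smul a r => rw [← heckeMul_smul_middle, op_smul_T, heckeMul_smul_T, ← heckeMul_T,
        heckeMul_T_right, rightProd_minWord]
  mul_one := h.heckeMul_T_one q
  mul_assoc := h.heckeMul_assoc hq
  smul_mul a x y := by rw [heckeMul_eq, heckeMul_eq, map_smul]
  smul_middle := h.heckeMul_smul_middle q
  mul_smul := h.heckeMul_op_smul hq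

variable (q)

theorem leftOp_T_one (x : Letter Λ S) : leftOp Λ S q x (T A 1) = T A x.val := by
  have hx : wordVal [x] = x.val := by simp [wordVal]
  have := h.leftProd_T_one q (A := A) (ω := [x]) (by
    rw [hx]
    rcases x with ⟨s, hs⟩ | e
    · exact (h.length_generator hs).symm
    · exact (length_mem_le e.2.1).symm)
  rw [hx] at this
  simpa [leftProd] using this

/-- The minimal word chosen for `x` need not be `[x]`. Both operators commute with the right
operators and agree on `T_1`, hence on every `T_r`. -/
theorem heckeMul_letter (x : Letter Λ S) (r : R) :
    h.heckeMul q (T A x.val) (T A r) = leftOp Λ S q x (T A r) := by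
  rw [heckeMul_T_right, ← h.leftOp_T_one q, ← h.rightProd_minWord q r]
  have hc : Commute (leftOp Λ S q x) (rightProd q (h.minWord r)) := by
    simpa [leftProd] using h.commute_leftProd_rightProd q [x] (h.minWord r)
  exact (LinearMap.congr_fun hc.eq (T A 1)).symm

variable {q}

theorem isHeckeMul_heckeMul (hq : q ∈ Subring.center A) : IsHeckeMul Λ S q (h.heckeMul q) where
  isAlgebraMul := h.isAlgebraMul_heckeMul hq
  simple_of_gt s hs r hr := (h.heckeMul_letter q (Sum.inl ⟨s, hs⟩) r).trans (leftOp_of_gt hr)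
  simple_of_eq s hs r hr := (h.heckeMul_letter q (Sum.inl ⟨s, hs⟩) r).trans (leftOp_of_eq (by
    rcases h.length_mul_left_cases hs r with h1 | h1 | h1
    · omega
    · omega
    · exact h1))
  simple_of_lt s hs r hr := (h.heckeMul_letter q (Sum.inl ⟨s, hs⟩) r).trans (leftOp_of_lt hr)
  idem e he r := (h.heckeMul_letter q (Sum.inr ⟨e, he⟩) r).trans (leftOp_idem _ _)

/-- The rules determine multiplication by letters, and associativity propagates this along a minimal
word of `r`, which determines `T_r y`. -/
theorem eq_heckeMul {mul : (R →₀ A) →+ (R →₀ A) →+ (R →₀ A)} (hm : IsHeckeMul Λ S q mul) :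
    mul = h.heckeMul q := by
  have halg := hm.isAlgebraMul
  have hT : ∀ (x : Letter Λ S) (r : R), mul (T A x.val) (T A r) = leftOp Λ S q x (T A r) := by
    intro x r
    rcases x with ⟨s, hs⟩ | ⟨e, he⟩
    · rcases h.length_mul_left_cases hs r with h1 | h1 | h1
      · rw [leftOp_of_gt h1]
        exact hm.simple_of_gt s hs r h1
      · rw [leftOp_of_lt h1]
        exact hm.simple_of_lt s hs r h1
      · rw [leftOp_of_eq h1]
        exact hm.simple_of_eq s hs r (by rw [h1])
    · rw [leftOp_idem]
      exact hm.idem e he r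
  have hop : ∀ (x : Letter Λ S) (y : R →₀ A), mul (T A x.val) y = leftOp Λ S q x y := by
    intro x y
    induction y using induction_T with
    | zero => simp
    | add y y' hy hy' => rw [map_add, map_add, hy, hy']
    -- `T_x (a T_r) = (T_x a) T_r = (a T_x) T_r`, so left linearity in the first factor suffices.
    | smul a r => rw [← halg.smul_middle, op_smul_T, halg.smul_mul, hT, map_smul]
  have hprod : ∀ (ω : List (Letter Λ S)) (y : R →₀ A),
      mul (leftProd q ω (T A 1)) y = leftProd q ω y := by
    intro ω y
    induction ω with
    | nil => exact halg.one_mul y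
    | cons x ω ih =>
      change mul (leftOp Λ S q x (leftProd q ω (T A 1))) y = leftOp Λ S q x (leftProd q ω y)
      rw [← hop, halg.mul_assoc, ih, hop]
  refine AddMonoidHom.ext fun x => AddMonoidHom.ext fun y => ?_
  induction x using induction_T with
  | zero => simp
  | add x x' hx hx' => rw [map_add, map_add, AddMonoidHom.add_apply, AddMonoidHom.add_apply, hx,
      hx']
  | smul a r => rw [halg.smul_mul, heckeMul_smul_T, ← hprod, leftProd_minWord]

theorem existsUnique_isHeckeMul (hq : q ∈ Subring.center A) :
    ∃! mul : (R →₀ A) →+ (R →₀ A) →+ (R →₀ A), IsHeckeMul Λ S q mul :=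
  ⟨h.heckeMul q, h.isHeckeMul_heckeMul hq, fun _ hm => h.eq_heckeMul hm⟩

end IsSystem

end Product

end RennerCoxeter

theorem mainTheorem3 {R : Type*} [Monoid R] (Λ : Set R) (S : Set Rˣ)
    (h : RennerCoxeter.IsSystem Λ S) :
    (∀ (A : Type*) [Ring A] (q : A), q ∈ Subring.center A →
      ∃! mul : (R →₀ A) →+ (R →₀ A) →+ (R →₀ A), RennerCoxeter.IsHeckeMul Λ S q mul) ∧
    (∃! mul : (R →₀ Polynomial ℤ) →+ (R →₀ Polynomial ℤ) →+ (R →₀ Polynomial ℤ),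
      RennerCoxeter.IsHeckeMul Λ S (Polynomial.X : Polynomial ℤ) mul) :=
  ⟨fun _ _ _ hq => h.existsUnique_isHeckeMul hq,
    h.existsUnique_isHeckeMul (Subring.mem_center_iff.2 fun _ => mul_comm _ _)⟩
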